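/- Let $\mathbb{F}=\mathbb{R}$ or $\mathbb{C}$; all spaces and embeddings are $\mathbb F$-linear. For $\delta\ge 0$ let $\mathrm{Emb}_\delta(X,Y)$ be the set of linear maps $T:X\to Y$ with $\frac{1}{1+\delta}\|x\|\le\|Tx\|\le(1+\delta)\|x\|$ for all $x\in X$, let $\mathrm{Emb}=\mathrm{Emb}_0$ (isometric embeddings), let $\mathrm{Iso}(E)$ be the group of surjective linear isometries of $E$, and write $X\equiv Y$ if $X$ and $Y$ are linearly isometric. For classes of finite-dimensional Banach spaces, $\mathcal H\le\mathcal G$ means that every $X\in\mathcal H$ is isometric to some $Y\in\mathcal G$, and $\mathcal H\equiv\mathcal G$ means $\mathcal H\le\mathcal G\le\mathcal H$; $\mathcal G_k$ is the class of the $k$-dimensional members of $\mathcal G$. $\mathrm{Age}(E)$ is the class of all finite-dimensional subspaces of $E$. A Banach space $E$ (possibly of finite dimension) is *$\mathcal G$-Fraïssé* if $\mathcal G\le\mathrm{Age}(E)$ and for all $k\in\mathbb N$, $\varepsilon>0$ there is $\delta>0$ such that for every $X\in\mathcal G_k$ the action of $\mathrm{Iso}(E)$ on $\mathrm{Emb}_\delta(X,E)$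 is $\varepsilon$-transitive: for all $\gamma,\eta\in\mathrm{Emb}_\delta(X,E)$ there is $g\in\mathrm{Iso}(E)$ with $\|g\circ\gamma-\eta\|<\varepsilon$. $E$ is *Fraïssé* if it is $\mathrm{Age}(E)$-Fraïssé. $[\mathcal G]$ is the class of Banach spaces $E$ such that for every finite-dimensional subspace $X\subseteq E$ and $\varepsilon>0$ there are a subspace $Y\subseteq E$ isometric to a member of $\mathcal G$ and a subspace $Z\subseteq Y$ with $\dim Z=\dim X$ and $\Lambda_E(X,Z)<\varepsilon$, where $\Lambda_E$ is the Hausdorff distance between the closed unit balls. $\mathrm{Flim}\,\mathcal G$ is, if it exists, the unique (up to isometry) separable $\mathcal G$-Fraïssé Banach space in $[\mathcal G]$. $\mathcal G$ is an *amalgamation class* if it contains a zero-dimensional space and for all $k$, $\varepsilon>0$ there is $\delta>0$ such that for all $X\in\mathcal G_k$, $Y,Z\in\mathcal G$, $\gamma\in\mathrm{Emb}_\delta(X,Y)$, $\eta\in\mathrm{Emb}_\delta(X,Z)$ there are $H\in\mathcal G$, $i\in\mathrm{Emb}(Y,H)$, $j\in\mathrm{Emb}(Z,H)$ with $\|i\circ\gamma-j\circ\eta\|\le\varepsilon$.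 $\mathcal G$ is *hereditary* if every space that embeds isometrically into a member of $\mathcal G$ is isometric to a member of $\mathcal G$. $\mathcal G$ is *$d_{BM}$-compact* if for each $k$ every sequence in $\mathcal G_k$ has a subsequence converging to a member of $\mathcal G_k$ for the Banach–Mazur pseudometric $d_{BM}(X,Y)=\log\inf_T\|T\|\|T^{-1}\|$ ($T:X\to Y$ isomorphisms; $d_{BM}=0$ in dimension $0$). A *Fraïssé class* is a hereditary $d_{BM}$-compact amalgamation class. A *modulus* is a map $\varpi:\mathbb N\times[0,\infty)\to[0,\infty)$ with each $\varpi(k,\cdot)$ nondecreasing and continuous at $0$ with value $0$; $\varpi^*(k,\delta)=\inf_{\delta'>\delta}\varpi(k,\delta')$. The amalgamation class $\mathcal G$ *has modulus $\varpi$* if for all $k$ and all $\delta,\varepsilon>0$ the amalgamation condition above holds for $\mathcal G_k$ and $\delta$ with the bound $\varpi(k,\delta)+\varepsilon$ in place of $\varepsilon$. $E$ *has $\mathcal G$-Fraïssé modulus $\varpi$* if for all $k$, $\delta\ge0$, $\varepsilon>0$ and $X\in\mathcal G_k$ the action of $\mathrm{Iso}(E)$ on $\mathrm{Emb}_\delta(X,E)$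 is $(\varpi(k,\delta)+\varepsilon)$-transitive. **Theorem.** Let $\mathcal G$ be a class of finite-dimensional Banach spaces over $\mathbb F$. 1. (Fraïssé correspondence) The following are equivalent: (a) $\mathcal G$ is a Fraïssé class; (b) $\mathcal G\equiv\mathrm{Age}(E)$ for some separable Fraïssé Banach space $E$; (c) $\mathcal G\equiv\mathrm{Age}(E)$ for a separable Fraïssé Banach space $E$ that is unique up to isometry with these properties, and $E=\mathrm{Flim}\,\mathcal G$. 2. (Existence) If $\mathcal G$ is an amalgamation class, then $E=\mathrm{Flim}\,\mathcal G$ exists; it has $\mathcal G$-Fraïssé modulus $\varpi^*$ for every modulus $\varpi$ of $\mathcal G$; and it is the inductive limit (in Banach spaces) of a sequence of members of $\mathcal G$ and isometric embeddings $X_n\to X_{n+1}$. 3. (Uniqueness) If $E$ and $F$ are separable $\mathcal G$-Fraïssé Banach spaces and $E\in[\mathcal G]$, then $F\in[\mathcal G]$ if and only if $E\equiv F$. 4. If $E=\mathrm{Flim}\,\mathcal G$ exists, then $E$ has infinite dimension if and only if the dimensions of the members of $\mathcal G$ are unbounded. -/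

import Mathlib

open scoped NNReal Topology
open Filter

universe u v

noncomputable section

namespace FraisseBanach

/-- A finite-dimensional Banach space over `𝕜` (completeness is automatic). -/
structure FDSpace (𝕜 : Type v) [RCLike 𝕜] : Type (max v (u + 1)) where
  carrier : Type u
  [normed : NormedAddCommGroup carrier]
  [space : NormedSpace 𝕜 carrier]
  [findim : FiniteDimensional 𝕜 carrier]

attribute [instance] FDSpace.normed FDSpace.space FDSpace.findim

instance (𝕜 : Type v) [RCLike 𝕜] : CoeSort (FDSpace.{u} 𝕜) (Type u) :=
  ⟨FDSpace.carrier⟩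

variable {𝕜 : Type v} [RCLike 𝕜]

/-- The dimension over `𝕜`. -/
def FDSpace.dim (X : FDSpace.{u} 𝕜) : ℕ := Module.finrank 𝕜 X

/-- `X ≡ Y`: there is a surjective linear isometry between `X` and `Y`. -/
def Isometric (𝕜 : Type v) [RCLike 𝕜] (X Y : Type u) [NormedAddCommGroup X] [NormedSpace 𝕜 X]
    [NormedAddCommGroup Y] [NormedSpace 𝕜 Y] : Prop :=
  Nonempty (X ≃ₗᵢ[𝕜] Y)

/-- `γ ∈ Emb_δ(X, Y)`: `(1 + δ)⁻¹ ‖x‖ ≤ ‖γ x‖ ≤ (1 + δ) ‖x‖` for all `x`. The isometric embeddings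
`Emb(X, Y) = Emb_0(X, Y)` are Mathlib's `X →ₗᵢ[𝕜] Y`. -/
def IsDeltaEmb {X Y : Type u} [NormedAddCommGroup X] [NormedSpace 𝕜 X]
    [NormedAddCommGroup Y] [NormedSpace 𝕜 Y] (δ : ℝ) (γ : X →L[𝕜] Y) : Prop :=
  ∀ x : X, 1 / (1 + δ) * ‖x‖ ≤ ‖γ x‖ ∧ ‖γ x‖ ≤ (1 + δ) * ‖x‖

/-- `𝓗 ≤ 𝓖`: every member of `𝓗` is isometric to some member of `𝓖`. -/
def ClassLE (H G : Set (FDSpace.{u} 𝕜)) : Prop :=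
  ∀ X ∈ H, ∃ Y ∈ G, Isometric 𝕜 X Y

/-- `𝓗 ≡ 𝓖`. -/
def ClassEquiv (H G : Set (FDSpace.{u} 𝕜)) : Prop :=
  ClassLE H G ∧ ClassLE G H

/-- `Age(E)`: the class of all finite-dimensional subspaces of `E`. -/
def Age (𝕜 : Type v) [RCLike 𝕜] (E : Type u) [NormedAddCommGroup E] [NormedSpace 𝕜 E] :
    Set (FDSpace.{u} 𝕜) :=
  {X | ∃ (S : Submodule 𝕜 E) (_ : FiniteDimensional 𝕜 S), X = ⟨S⟩}

/-- `𝓖_E`: the subspaces of `E` that are isometric to some member of `𝓖`. -/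
def copiesIn (G : Set (FDSpace.{u} 𝕜)) (E : Type u) [NormedAddCommGroup E] [NormedSpace 𝕜 E] :
    Set (Submodule 𝕜 E) :=
  {S | ∃ X ∈ G, Isometric 𝕜 X S}

/-- The gap `Λ_E(X, Y)`: the Hausdorff distance between the closed unit balls of `X` and `Y`. -/
def gap {E : Type u} [NormedAddCommGroup E] [NormedSpace 𝕜 E] (X Y : Submodule 𝕜 E) : ℝ :=
  Metric.hausdorffDist {x : E | x ∈ X ∧ ‖x‖ ≤ 1} {y : E | y ∈ Y ∧ ‖y‖ ≤ 1}

/-- `E ∈ [𝓖]`: the subspaces of members of `𝓖_E` are `Λ_E`-dense in `Age(E)`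
(as `Λ_E` is a metric on each `Age_n(E)`, the approximating space has the same dimension). -/
def InBracket (G : Set (FDSpace.{u} 𝕜)) (E : Type u) [NormedAddCommGroup E] [NormedSpace 𝕜 E] :
    Prop :=
  ∀ X : Submodule 𝕜 E, FiniteDimensional 𝕜 X → ∀ ε : ℝ, 0 < ε →
    ∃ Y ∈ copiesIn G E, ∃ Z : Submodule 𝕜 E, Z ≤ Y ∧
      Module.finrank 𝕜 Z = Module.finrank 𝕜 X ∧ gap X Z < ε

/-- The action by composition of `Iso(E)` on `Emb_δ(X, E)` is `ε`-transitive. -/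
def EpsTransitive (X E : Type u) [NormedAddCommGroup X] [NormedSpace 𝕜 X]
    [NormedAddCommGroup E] [NormedSpace 𝕜 E] (δ ε : ℝ) : Prop :=
  ∀ γ η : X →L[𝕜] E, IsDeltaEmb δ γ → IsDeltaEmb δ η →
    ∃ g : E ≃ₗᵢ[𝕜] E, ‖g.toLinearIsometry.toContinuousLinearMap.comp γ - η‖ < ε

/-- `E` is `𝓖`-Fraïssé (which presupposes `𝓖 ≤ Age(E)`). The space `E` may have finite
dimension. -/
def IsGFraisse (G : Set (FDSpace.{u} 𝕜)) (E : Type u) [NormedAddCommGroup E] [NormedSpace 𝕜 E] :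
    Prop :=
  ClassLE G (Age 𝕜 E) ∧
    ∀ (k : ℕ) (ε : ℝ), 0 < ε → ∃ δ : ℝ, 0 < δ ∧
      ∀ X ∈ G, X.dim = k → EpsTransitive (𝕜 := 𝕜) X E δ ε

/-- `E` is Fraïssé: it is `Age(E)`-Fraïssé. -/
def IsFraisse (𝕜 : Type v) [RCLike 𝕜] (E : Type u) [NormedAddCommGroup E] [NormedSpace 𝕜 E] :
    Prop :=
  IsGFraisse (Age 𝕜 E) E

/-- A modulus: increasing, and continuous at zero with value zero, in the second variable. -/
def IsModulus (w : ℕ → ℝ≥0 → ℝ≥0) : Prop :=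
  ∀ k, Monotone (w k) ∧ w k 0 = 0 ∧ ContinuousAt (w k) 0

/-- `ϖ*(k, δ) = inf {ϖ(k, δ') : δ' > δ}`. -/
def modulusStar (w : ℕ → ℝ≥0 → ℝ≥0) (k : ℕ) (δ : ℝ≥0) : ℝ≥0 :=
  ⨅ δ' : Set.Ioi δ, w k δ'

/-- `ϖ` is a `𝓖`-Fraïssé modulus (of stability) of the space `E`. -/
def HasGFraisseModulus (G : Set (FDSpace.{u} 𝕜)) (E : Type u) [NormedAddCommGroup E]
    [NormedSpace 𝕜 E] (w : ℕ → ℝ≥0 → ℝ≥0) : Prop :=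
  IsModulus w ∧ ∀ (k : ℕ) (δ : ℝ≥0) (ε : ℝ), 0 < ε → ∀ X ∈ G, X.dim = k →
    EpsTransitive (𝕜 := 𝕜) X E δ (w k δ + ε)

/-- The `δ`-isometric embeddings of `X` into members of `𝓖` amalgamate in `𝓖` up to `ε`. -/
def Amalgamates (G : Set (FDSpace.{u} 𝕜)) (X : FDSpace.{u} 𝕜) (δ ε : ℝ) : Prop :=
  ∀ Y ∈ G, ∀ Z ∈ G, ∀ (γ : X →L[𝕜] Y) (η : X →L[𝕜] Z), IsDeltaEmb δ γ → IsDeltaEmb δ η →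
    ∃ H ∈ G, ∃ (i : Y →ₗᵢ[𝕜] H) (j : Z →ₗᵢ[𝕜] H),
      ‖i.toContinuousLinearMap.comp γ - j.toContinuousLinearMap.comp η‖ ≤ ε

/-- `{0} ∈ 𝓖` (a space of dimension zero belongs to `𝓖`). -/
def HasZero (G : Set (FDSpace.{u} 𝕜)) : Prop := ∃ Z ∈ G, Z.dim = 0

/-- `𝓖` is an amalgamation class. -/
def IsAmalgamationClass (G : Set (FDSpace.{u} 𝕜)) : Prop :=
  HasZero G ∧ ∀ (k : ℕ) (ε : ℝ), 0 < ε → ∃ δ : ℝ, 0 < δ ∧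
    ∀ X ∈ G, X.dim = k → Amalgamates G X δ ε

/-- The amalgamation class `𝓖` has modulus `ϖ`. -/
def HasAmalgamationModulus (G : Set (FDSpace.{u} 𝕜)) (w : ℕ → ℝ≥0 → ℝ≥0) : Prop :=
  IsModulus w ∧ HasZero G ∧ ∀ (k : ℕ) (δ : ℝ≥0) (ε : ℝ), 0 < δ → 0 < ε →
    ∀ X ∈ G, X.dim = k → Amalgamates G X δ (w k δ + ε)

/-- The hereditary property. -/
def IsHereditary (G : Set (FDSpace.{u} 𝕜)) : Prop :=
  ∀ X ∈ G, ∀ Y : FDSpace.{u} 𝕜, Nonempty (Y →ₗᵢ[𝕜] X) → ∃ Y' ∈ G, Isometric 𝕜 Y Y'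

/-- The Banach-Mazur pseudometric `log inf ‖T‖ ‖T⁻¹‖`, for `X`, `Y` of the same dimension.
In dimension zero its value is `Real.log 0 = 0`. -/
def dBM (X Y : FDSpace.{u} 𝕜) : ℝ :=
  Real.log (⨅ T : X ≃L[𝕜] Y, ‖(T : X →L[𝕜] Y)‖ * ‖(T.symm : Y →L[𝕜] X)‖)

/-- `𝓖` is `d_BM`-compact: for every `k`, every sequence in `𝓖_k` has a subsequence that
`d_BM`-converges to a member of `𝓖_k`. -/
def IsBMCompact (G : Set (FDSpace.{u} 𝕜)) : Prop :=
  ∀ (k : ℕ) (X : ℕ → FDSpace.{u} 𝕜), (∀ n, X n ∈ G ∧ (X n).dim = k) →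
    ∃ Y ∈ G, Y.dim = k ∧ ∃ φ : ℕ → ℕ, StrictMono φ ∧
      Tendsto (fun n => dBM (X (φ n)) Y) atTop (𝓝 0)

/-- `𝓖` is a Fraïssé class. -/
def IsFraisseClass (G : Set (FDSpace.{u} 𝕜)) : Prop :=
  IsHereditary G ∧ IsBMCompact G ∧ IsAmalgamationClass G

/-- `E = Flim 𝓖`: the Banach space `E` is, up to isometry, the unique separable `𝓖`-Fraïssé Banach
space in `[𝓖]`. -/
structure IsFraisseLimit (G : Set (FDSpace.{u} 𝕜)) (E : Type u) [NormedAddCommGroup E]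
    [NormedSpace 𝕜 E] [CompleteSpace E] : Prop where
  separable : TopologicalSpace.SeparableSpace E
  fraisse : IsGFraisse G E
  bracket : InBracket G E
  unique : ∀ (F : Type u) [NormedAddCommGroup F] [NormedSpace 𝕜 F] [CompleteSpace F],
    TopologicalSpace.SeparableSpace F → IsGFraisse G F → InBracket G F → Isometric 𝕜 E F

/-- The Banach space `E` is (isometric to) the inductive limit of the sequence
`X 0 → X 1 → X 2 → ⋯` of isometric embeddings, that is, the completion of its direct limit. -/
def IsInductiveLimit (X : ℕ → FDSpace.{u} 𝕜) (I : ∀ n, X n →ₗᵢ[𝕜] X (n + 1)) (E : Type u)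
    [NormedAddCommGroup E] [NormedSpace 𝕜 E] [CompleteSpace E] : Prop :=
  ∃ J : ∀ n, X n →ₗᵢ[𝕜] E, (∀ n, (J (n + 1)).comp (I n) = J n) ∧
    Dense (⋃ n, Set.range (J n))

end FraisseBanach

end

namespace FraisseBanach

/-! Everything rests on two properties of a Banach space `E`. `ApproxBy` says that
finite-dimensional subspaces almost lie in isometric copies of members of `G`; it is equivalent to
`E ∈ [G]`. `HasExtensions` is a one-step extension property, and a `G`-Fraïssé space has it: embed
`Y` anywhere in `E`, then move it by an isometry.

Uniqueness is a back-and-forth argument (`exists_linearIsometryEquiv_near`). Two separable Banach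
spaces with both properties carry approximately coherent embeddings of one sequence in `G`, with
summable errors; pairs of limits along this sequence form an isometric relation with dense domain
and range, whose closure is the graph of a surjective isometry. Applied with `E = F`, the same
argument turns amalgamation in `G` into approximate transitivity of `Iso(E)`
(`Amalgamates.epsTransitive`).

For existence, Auerbach bases and Arzelà–Ascoli make `G` separable up to almost isometries, so
countably many amalgamations along one sequence in `G` suffice to absorb every extension
(`exists_fraisse_sequence`). The completed direct limit then has both properties, after almost
isometric extensions are corrected to isometric ones.

For the correspondence, heredity and compactness of `G` force the age of the limit into `G`.
Conversely, if `G ≡ Age(E)` with `E` Fraïssé, amalgams are sums of two subspaces of `E`. Compactness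
holds because spaces with converging coordinate norms can be moved by isometries of `E` until their
bases converge in `E` (`exists_realization`); the span of the limit basis is again in the age. -/

/-- Dependent choice along a sequence of steps. -/
theorem exists_seq_of_step {S : Type*} (P : ℕ → S → Prop) (R : ℕ → S → S → Prop) (s₀ : S)
    (h₀ : P 0 s₀) (step : ∀ n s, P n s → ∃ s', P (n + 1) s' ∧ R n s s') :
    ∃ f : ℕ → S, f 0 = s₀ ∧ (∀ n, P n (f n)) ∧ ∀ n, R n (f n) (f (n + 1)) := by
  choose F hF using step
  let g : ∀ n, {s // P n s} := fun n =>
    Nat.rec ⟨s₀, h₀⟩ (fun n s => ⟨F n s.1 s.2, (hF n s.1 s.2).1⟩) n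
  exact ⟨fun n => (g n).1, rfl, fun n => (g n).2, fun n => (hF n (g n).1 (g n).2).2⟩

variable {𝕜 : Type v} [RCLike 𝕜]

/-! ### Calculus of `δ`-embeddings -/

section DeltaEmb

variable {X Y Z : Type u} [NormedAddCommGroup X] [NormedSpace 𝕜 X] [NormedAddCommGroup Y]
  [NormedSpace 𝕜 Y] [NormedAddCommGroup Z] [NormedSpace 𝕜 Z]

theorem IsDeltaEmb.mono {δ δ' : ℝ} {γ : X →L[𝕜] Y} (h : IsDeltaEmb δ γ) (h0 : 0 ≤ δ)
    (hδ : δ ≤ δ') : IsDeltaEmb δ' γ := fun x =>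
  ⟨le_trans (by gcongr) (h x).1, (h x).2.trans (by gcongr)⟩

theorem IsDeltaEmb.isometry_comp {δ : ℝ} {γ : X →L[𝕜] Y} (h : IsDeltaEmb δ γ) (i : Y →ₗᵢ[𝕜] Z) :
    IsDeltaEmb δ (i.toContinuousLinearMap.comp γ) := fun x => by
  simpa using h x

theorem IsDeltaEmb.comp_isometry {δ : ℝ} {γ : Y →L[𝕜] Z} (h : IsDeltaEmb δ γ) (i : X →ₗᵢ[𝕜] Y) :
    IsDeltaEmb δ (γ.comp i.toContinuousLinearMap) := fun x => by
  simpa using h (i x)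

theorem isDeltaEmb_isometry {δ : ℝ} (h0 : 0 ≤ δ) (i : X →ₗᵢ[𝕜] Y) :
    IsDeltaEmb δ i.toContinuousLinearMap := fun x => by
  have h1 : 1 / (1 + δ) ≤ 1 := by rw [div_le_one (by linarith)]; linarith
  have := norm_nonneg x
  simp only [LinearIsometry.coe_toContinuousLinearMap, LinearIsometry.norm_map]
  constructor <;> nlinarith

/-- A perturbation of size `perturbRadius δ δ'` turns `δ`-embeddings into `δ'`-embeddings. -/
noncomputable def perturbRadius (δ δ' : ℝ) : ℝ := (δ' - δ) / ((1 + δ) * (1 + δ'))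

theorem perturbRadius_pos {δ δ' : ℝ} (h0 : 0 ≤ δ) (h : δ < δ') : 0 < perturbRadius δ δ' :=
  div_pos (by linarith) (mul_pos (by linarith) (by linarith))

theorem IsDeltaEmb.perturb {δ δ' : ℝ} (h0 : 0 ≤ δ) (h : δ < δ') {γ γ' : X →L[𝕜] Y}
    (hγ : IsDeltaEmb δ γ) (hγ' : ∀ x, ‖γ' x - γ x‖ ≤ perturbRadius δ δ' * ‖x‖) :
    IsDeltaEmb δ' γ' := fun x => by
  -- The radius is exactly the room between the two lower bounds; it is also at most the room `δ' -
  -- δ` between the upper bounds.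
  have e1 : perturbRadius δ δ' = 1 / (1 + δ) - 1 / (1 + δ') := by
    have h1 : 1 + δ ≠ 0 := by linarith
    have h2 : 1 + δ' ≠ 0 := by linarith
    unfold perturbRadius
    field_simp
    ring
  have e2 : perturbRadius δ δ' ≤ δ' - δ := by
    refine div_le_self (by linarith) ?_
    nlinarith
  have h1 := hγ' x
  have h2 := hγ x
  have h3 := norm_sub_norm_le (γ x) (γ' x)
  have h4 := norm_sub_norm_le (γ' x) (γ x)
  rw [norm_sub_rev] at h3
  have := norm_nonneg x
  constructor
  · have : perturbRadius δ δ' * ‖x‖ = 1 / (1 + δ) * ‖x‖ - 1 / (1 + δ') * ‖x‖ := by rw [e1]; ring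
    linarith
  · have : perturbRadius δ δ' * ‖x‖ ≤ (δ' - δ) * ‖x‖ := by gcongr
    linarith

theorem isDeltaEmb_of_near_isometry {δ : ℝ} (h : 0 < δ) (i : X →ₗᵢ[𝕜] Y) {γ : X →L[𝕜] Y}
    (hγ : ∀ x, ‖γ x - i x‖ ≤ perturbRadius 0 δ * ‖x‖) : IsDeltaEmb δ γ :=
  (isDeltaEmb_isometry le_rfl i).perturb le_rfl h hγ

theorem isDeltaEmb_of_abs_le {δ : ℝ} (h : 0 < δ) {γ : X →L[𝕜] Y}
    (hγ : ∀ x, |‖γ x‖ - ‖x‖| ≤ perturbRadius 0 δ * ‖x‖) : IsDeltaEmb δ γ := fun x => by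
  have e1 : perturbRadius 0 δ = 1 - 1 / (1 + δ) := by
    unfold perturbRadius
    field_simp
    ring
  have e2 : perturbRadius 0 δ ≤ δ := by
    unfold perturbRadius
    rw [div_le_iff₀ (by linarith)]
    nlinarith
  have h1 := abs_le.1 (hγ x)
  have := norm_nonneg x
  constructor
  · have : perturbRadius 0 δ * ‖x‖ = ‖x‖ - 1 / (1 + δ) * ‖x‖ := by rw [e1]; ring
    linarith
  · have : perturbRadius 0 δ * ‖x‖ ≤ δ * ‖x‖ := by gcongr
    linarith

theorem IsDeltaEmb.comp {δ δ' : ℝ} (h0' : 0 ≤ δ') {γ : X →L[𝕜] Y} {γ' : Y →L[𝕜] Z}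
    (h : IsDeltaEmb δ γ) (h' : IsDeltaEmb δ' γ') :
    IsDeltaEmb ((1 + δ) * (1 + δ') - 1) (γ'.comp γ) := fun x => by
  have e : 1 + ((1 + δ) * (1 + δ') - 1) = (1 + δ) * (1 + δ') := by ring
  rw [e]
  constructor
  · calc 1 / ((1 + δ) * (1 + δ')) * ‖x‖ = 1 / (1 + δ') * (1 / (1 + δ) * ‖x‖) := by
          rw [one_div_mul_eq_div, one_div_mul_eq_div, one_div_mul_eq_div, div_div]
      _ ≤ 1 / (1 + δ') * ‖γ x‖ := by gcongr; exact (h x).1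
      _ ≤ _ := (h' _).1
  · calc ‖γ' (γ x)‖ ≤ (1 + δ') * ‖γ x‖ := (h' _).2
      _ ≤ (1 + δ') * ((1 + δ) * ‖x‖) := by gcongr; exact (h x).2
      _ = _ := by ring

theorem IsDeltaEmb.injective {δ : ℝ} (h0 : 0 ≤ δ) {γ : X →L[𝕜] Y} (h : IsDeltaEmb δ γ) :
    Function.Injective γ := by
  refine (injective_iff_map_eq_zero γ).2 fun x hx => ?_
  have h1 := (h x).1
  rw [hx, norm_zero] at h1
  have : 0 < 1 / (1 + δ) := by positivity
  exact norm_le_zero_iff.1 (by nlinarith)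

/-- A limit of `δ n`-embeddings with `δ n → 0` is an isometric embedding. -/
theorem exists_isometry_of_tendsto {δ : ℕ → ℝ} (hδ : Tendsto δ atTop (𝓝 0)) {γ : ℕ → X →L[𝕜] Y}
    (h : ∀ n, IsDeltaEmb (δ n) (γ n)) {γ' : X →L[𝕜] Y}
    (hγ : ∀ x, Tendsto (fun n => γ n x) atTop (𝓝 (γ' x))) :
    ∃ i : X →ₗᵢ[𝕜] Y, ∀ x, i x = γ' x := by
  refine ⟨⟨γ'.toLinearMap, fun x => ?_⟩, fun x => rfl⟩
  have h1 := (hγ x).norm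
  have h2 : Tendsto (fun n => (1 + δ n) * ‖x‖) atTop (𝓝 ‖x‖) := by
    simpa using (hδ.const_add 1).mul_const ‖x‖
  have h3 : Tendsto (fun n => 1 / (1 + δ n) * ‖x‖) atTop (𝓝 ‖x‖) := by
    simpa using ((hδ.const_add 1).inv₀ (by simp)).mul_const ‖x‖
  exact le_antisymm (le_of_tendsto_of_tendsto' h1 h2 fun n => (h n x).2)
    (le_of_tendsto_of_tendsto' h3 h1 fun n => (h n x).1)

end DeltaEmb

/-! ### Approximation and extension properties, and the class `[G]` -/

/-- Finite-dimensional subspaces of `E` are approximately contained in copies of members of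
`G`. -/
def ApproxBy (G : Set (FDSpace.{u} 𝕜)) (E : Type u) [NormedAddCommGroup E] [NormedSpace 𝕜 E] :
    Prop :=
  ∀ V : Submodule 𝕜 E, FiniteDimensional 𝕜 V → ∀ ε : ℝ, 0 < ε →
    ∃ Y ∈ G, ∃ (j : Y →ₗᵢ[𝕜] E) (S : V →L[𝕜] Y), ∀ v : V, ‖j (S v) - v‖ ≤ ε * ‖v‖

/-- The extension property: almost isometric embeddings into `E` extend approximately to isometric
embeddings of larger members of `G`. -/
def HasExtensions (G : Set (FDSpace.{u} 𝕜)) (E : Type u) [NormedAddCommGroup E]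
    [NormedSpace 𝕜 E] : Prop :=
  ∀ (k : ℕ) (ε : ℝ), 0 < ε → ∃ δ : ℝ, 0 < δ ∧ ∀ X ∈ G, X.dim = k → ∀ Y ∈ G,
    ∀ (γ : X →L[𝕜] Y) (η : X →L[𝕜] E), IsDeltaEmb δ γ → IsDeltaEmb δ η →
      ∃ j : Y →ₗᵢ[𝕜] E, ∀ x, ‖j (γ x) - η x‖ ≤ ε * ‖x‖

section Spaces

variable {G : Set (FDSpace.{u} 𝕜)} {E F : Type u} [NormedAddCommGroup E] [NormedSpace 𝕜 E]
  [NormedAddCommGroup F] [NormedSpace 𝕜 F]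

theorem exists_isometry_of_classLE_age (h : ClassLE G (Age 𝕜 E)) {X : FDSpace.{u} 𝕜}
    (hX : X ∈ G) : Nonempty (X →ₗᵢ[𝕜] E) := by
  obtain ⟨Y, ⟨S, hS, rfl⟩, ⟨e⟩⟩ := h X hX
  exact ⟨S.subtypeₗᵢ.comp e.toLinearIsometry⟩

theorem classLE_age_of_isometry (h : ∀ X ∈ G, Nonempty (X →ₗᵢ[𝕜] E)) : ClassLE G (Age 𝕜 E) := by
  intro X hX
  obtain ⟨i⟩ := h X hX
  exact ⟨⟨LinearMap.range i.toLinearMap⟩, ⟨_, inferInstance, rfl⟩, ⟨i.equivRange⟩⟩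

/-- Any isometric copy `i` of `Y` in `E` will do: `i ∘ γ` and `η` are both `δ`-embeddings of `X`, so
an isometry of `E` carries the first close to the second. -/
theorem IsGFraisse.hasExtensions (h : IsGFraisse G E) : HasExtensions G E := by
  intro k ε hε
  obtain ⟨δ, hδ, H⟩ := h.2 k ε hε
  refine ⟨δ, hδ, fun X hX hk Y hY γ η hγ hη => ?_⟩
  obtain ⟨i⟩ := exists_isometry_of_classLE_age h.1 hY
  obtain ⟨g, hg⟩ := H X hX hk _ η (hγ.isometry_comp i) hη
  refine ⟨g.toLinearIsometry.comp i, fun x => ?_⟩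
  exact (ContinuousLinearMap.le_opNorm (g.toLinearIsometry.toContinuousLinearMap.comp
    (i.toContinuousLinearMap.comp γ) - η) x).trans (by gcongr)

theorem ApproxBy.of_isometric (h : ApproxBy G E) (e : E ≃ₗᵢ[𝕜] F) : ApproxBy G F := by
  intro V hV ε hε
  obtain ⟨Y, hY, j, S, hS⟩ := h (V.map e.symm.toLinearEquiv.toLinearMap) inferInstance ε hε
  let T : V →ₗ[𝕜] V.map e.symm.toLinearEquiv.toLinearMap :=
    (e.symm.toLinearEquiv.toLinearMap.domRestrict V).codRestrict _
      fun v => Submodule.mem_map_of_mem v.2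
  refine ⟨Y, hY, e.toLinearIsometry.comp j, S.comp (LinearMap.toContinuousLinearMap T),
    fun v => ?_⟩
  have hT : ((T v : _) : E) = e.symm v := rfl
  have h1 := hS (T v)
  have h2 : ‖T v‖ = ‖v‖ := by
    change ‖((T v : _) : E)‖ = _
    rw [hT]; simp
  rw [h2, hT] at h1
  rw [← e.symm.norm_map, map_sub]
  change ‖e.symm (e (j (S (T v)))) - e.symm v‖ ≤ _
  rwa [e.symm_apply_apply]

theorem exists_approx_of_gap_lt {X Z : Submodule 𝕜 E} {ε : ℝ} (h : gap X Z < ε) {x : E}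
    (hx : x ∈ X) (hx1 : ‖x‖ ≤ 1) : ∃ z ∈ Z, ‖z - x‖ < ε := by
  obtain ⟨z, hz, hd⟩ := Metric.exists_dist_lt_of_hausdorffDist_lt
    (s := {x : E | x ∈ X ∧ ‖x‖ ≤ 1}) (t := {y : E | y ∈ Z ∧ ‖y‖ ≤ 1}) (x := x) ⟨hx, hx1⟩ h
    (Metric.hausdorffEDist_ne_top_of_nonempty_of_bounded ⟨0, by simp⟩ ⟨0, by simp⟩
      ((Metric.isBounded_closedBall (x := 0) (r := 1)).subset fun y hy => by simpa using hy.2)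
      ((Metric.isBounded_closedBall (x := 0) (r := 1)).subset fun y hy => by simpa using hy.2))
  exact ⟨z, hz.1, by rwa [dist_comm, dist_eq_norm] at hd⟩

/-- Approximating the vectors of a basis yields an approximation of the whole subspace. -/
theorem exists_approx_of_near_basis (V : Submodule 𝕜 E) [FiniteDimensional 𝕜 V] {ε : ℝ}
    (hε : 0 < ε) : ∃ ρ : ℝ, 0 < ρ ∧ ∀ (Y : FDSpace.{u} 𝕜) (j : Y →ₗᵢ[𝕜] E),
      (∀ l, ∃ y, ‖j y - Module.finBasis 𝕜 V l‖ ≤ ρ) →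
        ∃ S : V →L[𝕜] Y, ∀ v : V, ‖j (S v) - v‖ ≤ ε * ‖v‖ := by
  let b := Module.finBasis 𝕜 V
  let c := LinearMap.toContinuousLinearMap b.equivFun.toLinearMap
  have hC : 0 < ‖c‖ * Module.finrank 𝕜 V + 1 := by positivity
  -- Each coordinate of `v` is at most `‖c‖ * ‖v‖`, so the errors add up to at most `ρ * ‖c‖ *
  -- finrank * ‖v‖`; the `+ 1` guards against a zero denominator.
  refine ⟨ε / (‖c‖ * Module.finrank 𝕜 V + 1), by positivity, fun Y j hj => ?_⟩
  choose y hy using hj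
  let S := LinearMap.toContinuousLinearMap (b.constr 𝕜 y)
  refine ⟨S, fun v => ?_⟩
  have e1 : j (S v) = ∑ l, b.repr v l • j (y l) := by
    simp [S, Module.Basis.constr_apply_fintype]
  have e2 : (v : E) = ∑ l, b.repr v l • (b l : E) := by
    have := congrArg V.subtype (b.sum_repr v).symm
    simpa only [map_sum, map_smul, Submodule.subtype_apply] using this
  calc ‖j (S v) - v‖ = ‖∑ l, b.repr v l • (j (y l) - (b l : E))‖ := by
        rw [e1]
        conv_lhs => rw [e2]
        simp [smul_sub]
    _ ≤ ∑ l : Fin (Module.finrank 𝕜 V), ‖c‖ * ‖v‖ * (ε / (‖c‖ * Module.finrank 𝕜 V + 1)) := by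
        refine norm_sum_le_of_le _ fun l _ => ?_
        rw [norm_smul]
        gcongr
        · exact (norm_le_pi_norm (c v) l).trans (c.le_opNorm v)
        · exact hy l
    _ = ε * ‖v‖ * ((‖c‖ * Module.finrank 𝕜 V) / (‖c‖ * Module.finrank 𝕜 V + 1)) := by
        simp; ring
    _ ≤ ε * ‖v‖ * 1 := by
        gcongr
        rw [div_le_one hC]; linarith
    _ = ε * ‖v‖ := by ring

theorem InBracket.approxBy (h : InBracket G E) : ApproxBy G E := by
  intro V hV ε₀ hε₀
  obtain ⟨ε, hε, H⟩ := exists_approx_of_near_basis V hε₀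
  let b := Module.finBasis 𝕜 V
  -- The gap compares unit balls only: the basis is shrunk by `M` into the unit ball, and scaling
  -- back turns the error `ε / M` into `ε`.
  let M := ∑ l, ‖b l‖ + 1
  have hM : 0 < M := by positivity
  obtain ⟨W, ⟨Y, hY, ⟨e⟩⟩, Z, hZ, -, hg⟩ := h V hV (ε / M) (by positivity)
  refine ⟨Y, hY, W.subtypeₗᵢ.comp e.toLinearIsometry, H _ _ fun l => ?_⟩
  have hb : ‖b l‖ ≤ M := by
    have := Finset.single_le_sum (f := fun l => ‖b l‖) (fun i _ => norm_nonneg _)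
      (Finset.mem_univ l)
    simp only [M]; linarith
  obtain ⟨z, hz, hd⟩ := exists_approx_of_gap_lt hg (x := ((M : 𝕜)⁻¹ • b l : V)) (Subtype.prop _) (by
    rw [← Submodule.coe_norm, norm_smul, norm_inv, RCLike.norm_ofReal, abs_of_pos hM, inv_mul_le_iff₀ hM]
    linarith)
  refine ⟨e.symm ⟨(M : 𝕜) • z, hZ (Z.smul_mem _ hz)⟩, ?_⟩
  have hM' : (M : 𝕜) ≠ 0 := by exact_mod_cast hM.ne'
  have : (M : 𝕜) • z - (b l : E) = (M : 𝕜) • (z - ((M : 𝕜)⁻¹ • b l : V)) := by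
    simp [smul_sub, smul_smul, hM']
  simp only [LinearIsometry.coe_comp, Function.comp_apply, LinearIsometryEquiv.coe_toLinearIsometry,
    LinearIsometryEquiv.apply_symm_apply, Submodule.coe_subtypeₗᵢ, Submodule.coe_subtype]
  rw [this, norm_smul, RCLike.norm_ofReal, abs_of_pos hM]
  rw [lt_div_iff₀ hM] at hd
  linarith

/-- The approximating map `T` moves vectors by a factor `ρ < 1` of their norm, so it is injective
and its range has the right dimension. To stay inside unit balls, `T x` is divided by `1 + ρ` in one
direction and the preimage is multiplied by `1 - ρ` in the other; both cost at most `4 * ρ`. -/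
theorem ApproxBy.inBracket (h : ApproxBy G E) : InBracket G E := by
  intro X hX ε hε
  let ρ := min (ε / 8) (1 / 2)
  have hρ : 0 < ρ := by positivity
  have hρ1 : ρ ≤ ε / 8 := min_le_left _ _
  have hρ2 : ρ ≤ 1 / 2 := min_le_right _ _
  obtain ⟨Y, hY, j, S, hS⟩ := h X hX ρ hρ
  let T : X →ₗ[𝕜] E := j.toLinearMap ∘ₗ S.toLinearMap
  have hT : ∀ x, ‖T x - x‖ ≤ ρ * ‖x‖ := hS
  have hlow : ∀ x : X, (1 - ρ) * ‖x‖ ≤ ‖T x‖ := fun x => by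
    have h1 := norm_sub_norm_le (x : E) (T x)
    rw [norm_sub_rev] at h1
    have := hT x
    have e : ‖(x : E)‖ = ‖x‖ := rfl
    linarith
  have hup : ∀ x : X, ‖T x‖ ≤ (1 + ρ) * ‖x‖ := fun x => by
    have h1 := norm_sub_norm_le (T x) (x : E)
    have := hT x
    have e : ‖(x : E)‖ = ‖x‖ := rfl
    linarith
  have hinj : Function.Injective T := (injective_iff_map_eq_zero T).2 fun x hx => by
    have := hlow x
    rw [hx, norm_zero] at this
    exact norm_le_zero_iff.1 (by nlinarith [norm_nonneg x])
  refine ⟨LinearMap.range j.toLinearMap, ⟨Y, hY, ⟨j.equivRange⟩⟩, LinearMap.range T,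
    LinearMap.range_comp_le_range _ _, LinearMap.finrank_range_of_inj hinj, ?_⟩
  refine lt_of_le_of_lt (Metric.hausdorffDist_le_of_mem_dist (r := 4 * ρ) (by positivity) ?_ ?_)
    (by linarith)
  · rintro x ⟨hx, hx1⟩
    have hp : (0 : ℝ) < 1 + ρ := by positivity
    have hxx : ‖(⟨x, hx⟩ : X)‖ ≤ 1 := hx1
    have hn : ‖((1 + ρ : ℝ) : 𝕜)⁻¹‖ = (1 + ρ)⁻¹ := by
      rw [norm_inv, RCLike.norm_ofReal, abs_of_pos hp]
    have hup' := hup ⟨x, hx⟩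
    have hT' := hT ⟨x, hx⟩
    have hTb : ‖T ⟨x, hx⟩‖ ≤ 1 + ρ := hup'.trans (by nlinarith)
    refine ⟨((1 + ρ : ℝ) : 𝕜)⁻¹ • T ⟨x, hx⟩, ⟨Submodule.smul_mem _ _ ⟨_, rfl⟩, ?_⟩, ?_⟩
    · rw [norm_smul, hn, inv_mul_le_iff₀ hp]
      linarith
    · have e : T ⟨x, hx⟩ - ((1 + ρ : ℝ) : 𝕜)⁻¹ • T ⟨x, hx⟩
          = (((1 + ρ : ℝ) : 𝕜)⁻¹ * (ρ : 𝕜)) • T ⟨x, hx⟩ := by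
        have : ((1 + ρ : ℝ) : 𝕜) ≠ 0 := by exact_mod_cast hp.ne'
        have h' : (((1 + ρ : ℝ) : 𝕜)⁻¹ * (ρ : 𝕜)) = 1 - ((1 + ρ : ℝ) : 𝕜)⁻¹ := by
          field_simp
          push_cast; ring
        rw [h', sub_smul, one_smul]
      rw [dist_eq_norm, ← sub_add_sub_cancel x (T ⟨x, hx⟩), e]
      refine (norm_add_le _ _).trans ?_
      rw [norm_smul, norm_mul, hn, RCLike.norm_ofReal, abs_of_pos hρ, norm_sub_rev]
      have h2 : (1 + ρ)⁻¹ * ρ * ‖T ⟨x, hx⟩‖ ≤ ρ := by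
        rw [mul_assoc, inv_mul_le_iff₀ hp]
        nlinarith
      have h3 : ‖T ⟨x, hx⟩ - x‖ ≤ ρ := hT'.trans (by nlinarith)
      linarith
  · rintro z ⟨⟨x, rfl⟩, hz⟩
    have hp : (0 : ℝ) < 1 - ρ := by linarith
    have h1 := hlow x
    have hx2 : ‖x‖ ≤ 2 := by nlinarith [norm_nonneg x]
    refine ⟨(((1 - ρ : ℝ) : 𝕜) • x : X), ⟨Subtype.prop _, ?_⟩, ?_⟩
    · rw [← Submodule.coe_norm, norm_smul, RCLike.norm_ofReal, abs_of_pos hp]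
      linarith
    · have e : (((1 - ρ : ℝ) : 𝕜) • x : X) = x - (ρ : 𝕜) • x := by
        push_cast; rw [sub_smul, one_smul]
      rw [e, dist_eq_norm]
      have e2 : T x - ((x - (ρ : 𝕜) • x : X) : E) = (T x - x) + (ρ : 𝕜) • (x : E) := by
        simp; abel
      rw [e2]
      refine (norm_add_le _ _).trans ?_
      rw [norm_smul, RCLike.norm_ofReal, abs_of_pos hρ]
      have := hT x
      have e3 : ‖(x : E)‖ = ‖x‖ := rfl
      rw [e3]
      nlinarith

end Spaces

end FraisseBanach
namespace FraisseBanach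

variable {𝕜 : Type v} [RCLike 𝕜]

/-! ### From isometric relations to isometries -/

section Gluing

variable {E F : Type u} [NormedAddCommGroup E] [NormedSpace 𝕜 E] [CompleteSpace E]
  [NormedAddCommGroup F] [NormedSpace 𝕜 F] [CompleteSpace F]

/-- An isometric linear relation with dense domain, between Banach spaces, extends to an everywhere
defined isometric embedding onto the first factor. -/
theorem exists_equiv_fst_closure (Γ : Submodule 𝕜 (E × F)) (h : ∀ z ∈ Γ, ‖z.1‖ = ‖z.2‖)
    (hd : Dense (Prod.fst '' (Γ : Set (E × F)))) :
    ∃ e : Γ.topologicalClosure ≃ₗᵢ[𝕜] E, ∀ z, e z = (z : E × F).1 := by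
  have hn : ∀ z ∈ Γ.topologicalClosure, ‖z.1‖ = ‖z.2‖ := by
    have hc : IsClosed {z : E × F | ‖z.1‖ = ‖z.2‖} := isClosed_eq (by fun_prop) (by fun_prop)
    exact fun z hz => closure_minimal h hc hz
  let p : Γ.topologicalClosure →ₗᵢ[𝕜] E :=
    ⟨LinearMap.fst 𝕜 E F ∘ₗ Γ.topologicalClosure.subtype, fun z => by
      change ‖(z : E × F).1‖ = ‖(z : E × F)‖
      rw [Prod.norm_def, ← hn z z.2, max_self]⟩
  have : CompleteSpace Γ.topologicalClosure :=
    Γ.isClosed_topologicalClosure.completeSpace_coe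
  have hs : Function.Surjective p := by
    have h1 : IsClosed (Set.range p) := p.isometry.isClosedEmbedding.isClosed_range
    have h2 : Prod.fst '' (Γ : Set (E × F)) ⊆ Set.range p := by
      rintro _ ⟨z, hz, rfl⟩
      exact ⟨⟨z, Γ.le_topologicalClosure hz⟩, rfl⟩
    rw [← Set.range_eq_univ, ← h1.closure_eq]
    exact (hd.mono h2).closure_eq
  exact ⟨LinearIsometryEquiv.ofSurjective p hs, fun z => rfl⟩

/-- An isometric linear relation between Banach spaces with dense domain and dense image extends to
a surjective linear isometry. -/
theorem exists_linearIsometryEquiv_of_relation (Γ : Submodule 𝕜 (E × F))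
    (h : ∀ z ∈ Γ, ‖z.1‖ = ‖z.2‖) (hE : Dense (Prod.fst '' (Γ : Set (E × F))))
    (hF : Dense (Prod.snd '' (Γ : Set (E × F)))) :
    ∃ g : E ≃ₗᵢ[𝕜] F, ∀ z ∈ Γ, g z.1 = z.2 := by
  obtain ⟨e, he⟩ := exists_equiv_fst_closure Γ h hE
  let s := LinearEquiv.prodComm 𝕜 F E
  have hcomap : ∀ z : F × E, z ∈ Γ.comap s.toLinearMap ↔ (z.2, z.1) ∈ Γ := fun z => Iff.rfl
  obtain ⟨f, hf⟩ := exists_equiv_fst_closure (Γ.comap s.toLinearMap)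
    (fun z hz => (h _ ((hcomap z).1 hz)).symm) (by
      convert hF using 1
      ext y
      constructor
      · rintro ⟨z, hz, rfl⟩
        exact ⟨_, (hcomap z).1 hz, rfl⟩
      · rintro ⟨z, hz, rfl⟩
        exact ⟨(z.2, z.1), hz, rfl⟩)
  let t : Γ.topologicalClosure → (Γ.comap s.toLinearMap).topologicalClosure := fun z =>
    ⟨((z : E × F).2, (z : E × F).1), by
      have h1 : Set.MapsTo (Prod.swap : E × F → F × E) Γ (Γ.comap s.toLinearMap) :=
        fun z hz => hz
      exact h1.closure continuous_swap z.2⟩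
  have hfac : ∀ z, f (t z) = (z : E × F).2 := fun z => hf _
  have hnorm : ∀ z : Γ.topologicalClosure, ‖(z : E × F).2‖ = ‖z‖ := fun z => by
    rw [← hfac, f.norm_map]
    change ‖((z : E × F).2, (z : E × F).1)‖ = ‖(z : E × F)‖
    rw [Prod.norm_def, Prod.norm_def, max_comm]
  let q : Γ.topologicalClosure →ₗᵢ[𝕜] F :=
    ⟨LinearMap.snd 𝕜 E F ∘ₗ Γ.topologicalClosure.subtype, hnorm⟩
  have hq : Function.Surjective q := fun y => by
    have h2 : Set.MapsTo (Prod.swap : F × E → E × F) (Γ.comap s.toLinearMap) Γ :=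
      fun z hz => hz
    refine ⟨⟨((f.symm y : F × E).2, (f.symm y : F × E).1),
      h2.closure continuous_swap (f.symm y).2⟩, ?_⟩
    change ((f.symm y : _) : F × E).1 = y
    rw [← hf, f.apply_symm_apply]
  refine ⟨e.symm.trans (LinearIsometryEquiv.ofSurjective q hq), fun z hz => ?_⟩
  have h3 : e ⟨z, Γ.le_topologicalClosure hz⟩ = z.1 := he _
  rw [← h3, LinearIsometryEquiv.trans_apply, e.symm_apply_apply]
  rfl

end Gluing

/-! ### Limits along approximately coherent embeddings -/

section Sequences

variable {X : ℕ → FDSpace.{u} 𝕜} (u : ∀ n, X n →L[𝕜] X (n + 1))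

open Classical in
/-- The sequence of images of `x : X n` under the connecting maps, zero before `n`. -/
noncomputable def orbitFrom (n : ℕ) (x : X n) : ∀ m, X m
  | 0 => if h : n = 0 then h ▸ x else 0
  | m + 1 => if h : n = m + 1 then h ▸ x else u m (orbitFrom n x m)

theorem orbitFrom_self (n : ℕ) (x : X n) : orbitFrom u n x n = x := by
  cases n <;> simp [orbitFrom]

theorem orbitFrom_succ {n m : ℕ} (h : n ≤ m) (x : X n) :
    orbitFrom u n x (m + 1) = u m (orbitFrom u n x m) := by
  have : n ≠ m + 1 := by omega
  simp [orbitFrom, this]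

theorem orbitFrom_add (n : ℕ) (x y : X n) (m : ℕ) :
    orbitFrom u n (x + y) m = orbitFrom u n x m + orbitFrom u n y m := by
  induction m with
  | zero =>
    by_cases h : n = 0
    · subst h; simp [orbitFrom]
    · simp [orbitFrom, h]
  | succ m ih =>
    by_cases h : n = m + 1
    · subst h; simp [orbitFrom]
    · simp [orbitFrom, h, ih]

theorem orbitFrom_smul (n : ℕ) (c : 𝕜) (x : X n) (m : ℕ) :
    orbitFrom u n (c • x) m = c • orbitFrom u n x m := by
  induction m with
  | zero =>
    by_cases h : n = 0
    · subst h; simp [orbitFrom]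
    · simp [orbitFrom, h]
  | succ m ih =>
    by_cases h : n = m + 1
    · subst h; simp [orbitFrom]
    · simp [orbitFrom, h, ih]

variable {u} {E : Type u} [NormedAddCommGroup E] [NormedSpace 𝕜 E]
  {α : ∀ n, X n →ₗᵢ[𝕜] E} {ε : ℝ}

/-- The factor `2 - (1 / 2) ^ m` makes the induction close: step `m` adds at most `(1 / 2) ^ (m + 2)
* 2 * ‖x‖`, which is its increment. Only the consequence `≤ 2 * ‖x‖` is used. -/
theorem norm_orbitFrom_le (hε1 : ε ≤ 1)
    (h : ∀ n x, ‖α (n + 1) (u n x) - α n x‖ ≤ ε * (1 / 2) ^ (n + 2) * ‖x‖) (n : ℕ) (x : X n)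
    {m : ℕ} (hm : n ≤ m) : ‖orbitFrom u n x m‖ ≤ (2 - (1 / 2) ^ m) * ‖x‖ := by
  have hx := norm_nonneg x
  induction m, hm using Nat.le_induction with
  | base =>
    rw [orbitFrom_self]
    have : ((1 : ℝ) / 2) ^ n ≤ 1 := pow_le_one₀ (by norm_num) (by norm_num)
    nlinarith
  | succ m hm ih =>
    rw [orbitFrom_succ u hm]
    set y := orbitFrom u n x m
    have h1 := h m y
    have h2 := norm_sub_norm_le (α (m + 1) (u m y)) (α m y)
    rw [LinearIsometry.norm_map, LinearIsometry.norm_map] at h2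
    have h3 : ε * (1 / 2) ^ (m + 2) * ‖y‖ ≤ 1 * (1 / 2) ^ (m + 2) * (2 * ‖x‖) := by
      have : ‖y‖ ≤ 2 * ‖x‖ := ih.trans (by
        have : (0 : ℝ) ≤ (1 / 2) ^ m := by positivity
        nlinarith)
      gcongr
    have h4 : ((1 : ℝ) / 2) ^ (m + 2) = (1 / 2) ^ m / 4 := by ring
    have h5 : ((1 : ℝ) / 2) ^ (m + 1) = (1 / 2) ^ m / 2 := by ring
    rw [h4] at h1 h3
    rw [h5]
    nlinarith

/-- Since the orbit of `x` stays below `2 * ‖x‖`, its images in `E` move by geometrically decreasing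
amounts, whose sum from `n` on is the stated bound. -/
theorem exists_limit_orbitFrom [CompleteSpace E] (hε : 0 ≤ ε) (hε1 : ε ≤ 1)
    (h : ∀ n x, ‖α (n + 1) (u n x) - α n x‖ ≤ ε * (1 / 2) ^ (n + 2) * ‖x‖) (n : ℕ) (x : X n) :
    ∃ e : E, Tendsto (fun m => α m (orbitFrom u n x m)) atTop (𝓝 e) ∧
      ‖e - α n x‖ ≤ ε * (1 / 2) ^ n * ‖x‖ := by
  let f : ℕ → E := fun l => α (l + n) (orbitFrom u n x (l + n))
  have hf : ∀ l, dist (f l) (f (l + 1)) ≤ ε * (1 / 2) ^ n * ‖x‖ / 2 / 2 ^ l := fun l => by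
    have h1 := h (l + n) (orbitFrom u n x (l + n))
    have h2 := norm_orbitFrom_le hε1 h n x (show n ≤ l + n by omega)
    rw [← orbitFrom_succ u (show n ≤ l + n by omega)] at h1
    have e : f (l + 1) = α (l + n + 1) (orbitFrom u n x (l + n + 1)) := by
      have : l + 1 + n = l + n + 1 := by omega
      simp only [f]
      rw [this]
    rw [dist_comm, dist_eq_norm, e]
    refine h1.trans ?_
    have h3 : ‖orbitFrom u n x (l + n)‖ ≤ 2 * ‖x‖ := h2.trans (by
      have : (0 : ℝ) ≤ (1 / 2) ^ (l + n) := by positivity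
      nlinarith [norm_nonneg x])
    calc ε * (1 / 2) ^ (l + n + 2) * ‖orbitFrom u n x (l + n)‖
        ≤ ε * (1 / 2) ^ (l + n + 2) * (2 * ‖x‖) := by gcongr
      _ = _ := by rw [pow_add, pow_add, one_div_pow (2 : ℝ) l]; ring
  obtain ⟨e, he⟩ := cauchySeq_tendsto_of_complete (cauchySeq_of_le_geometric_two hf)
  refine ⟨e, (tendsto_add_atTop_iff_nat n).1 he, ?_⟩
  have := dist_le_of_le_geometric_two_of_tendsto₀ hf he
  rw [dist_comm, dist_eq_norm] at this
  have e0 : f 0 = α n x := by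
    have : 0 + n = n := by omega
    simp only [f]
    rw [this, orbitFrom_self]
  rwa [e0] at this

end Sequences

/-! ### Back-and-forth -/

/-- A member of `G` with isometric embeddings into `E` and `F`. -/
structure BiEmbedding (G : Set (FDSpace.{u} 𝕜)) (E F : Type u) [NormedAddCommGroup E]
    [NormedSpace 𝕜 E] [NormedAddCommGroup F] [NormedSpace 𝕜 F] where
  space : FDSpace.{u} 𝕜
  mem : space ∈ G
  left : space →ₗᵢ[𝕜] E
  right : space →ₗᵢ[𝕜] F

section BackForth

variable {G : Set (FDSpace.{u} 𝕜)} {E F : Type u} [NormedAddCommGroup E] [NormedSpace 𝕜 E]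
  [NormedAddCommGroup F] [NormedSpace 𝕜 F]

/-- A member `Y` of `G` almost containing both `β X` and `V` is found inside `F`. Restricted to `β
X`, the approximation is a `δ`-embedding `u` of `X` into `Y`, along which `α` extends to `Y` in `E`.
-/
theorem exists_forth (hE : HasExtensions G E) (hF : ApproxBy G F) {X : FDSpace.{u} 𝕜} (hX : X ∈ G)
    (α : X →ₗᵢ[𝕜] E) (β : X →ₗᵢ[𝕜] F) {ε : ℝ} (hε : 0 < ε) (V : Submodule 𝕜 F)
    [FiniteDimensional 𝕜 V] :
    ∃ Y ∈ G, ∃ (α' : Y →ₗᵢ[𝕜] E) (β' : Y →ₗᵢ[𝕜] F) (u : X →L[𝕜] Y),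
      (∀ x, ‖α' (u x) - α x‖ ≤ ε * ‖x‖) ∧ (∀ x, ‖β' (u x) - β x‖ ≤ ε * ‖x‖) ∧
      ∀ v ∈ V, ∃ y, ‖β' y - v‖ ≤ ε * ‖v‖ := by
  obtain ⟨δ, hδ, H⟩ := hE X.dim ε hε
  let W := LinearMap.range β.toLinearMap ⊔ V
  let ρ := min ε (perturbRadius 0 δ)
  have hρ : 0 < ρ := lt_min hε (perturbRadius_pos le_rfl hδ)
  obtain ⟨Y, hY, j, S, hS⟩ := hF W inferInstance ρ hρ
  let b : X →ₗᵢ[𝕜] W :=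
    ⟨β.toLinearMap.codRestrict W fun x => Submodule.mem_sup_left ⟨x, rfl⟩, fun x => β.norm_map x⟩
  let u : X →L[𝕜] Y := S.comp b.toContinuousLinearMap
  have hu : ∀ x, ‖j (u x) - β x‖ ≤ ρ * ‖x‖ := fun x => by
    have := hS (b x)
    rw [b.norm_map] at this
    exact this
  have hu' : IsDeltaEmb δ u := by
    have h1 : IsDeltaEmb δ (j.toContinuousLinearMap.comp u) :=
      isDeltaEmb_of_near_isometry hδ β fun x => (hu x).trans (by gcongr; exact min_le_right _ _)
    intro x
    simpa using h1 x
  obtain ⟨α', hα'⟩ := H X hX rfl Y hY u α.toContinuousLinearMap hu'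
    (isDeltaEmb_isometry hδ.le α)
  refine ⟨Y, hY, α', j, u, hα', fun x => (hu x).trans (by gcongr; exact min_le_left _ _),
    fun v hv => ⟨S ⟨v, Submodule.mem_sup_right hv⟩, (hS _).trans ?_⟩⟩
  change ρ * ‖v‖ ≤ _
  gcongr; exact min_le_left _ _

/-- Two uses of `exists_forth`, the second with `E` and `F` exchanged. The second error is measured
on `u x`, of norm at most `2 * ‖x‖`, whence `3 * ρ ≤ ε` in total. -/
theorem exists_back_and_forth (hE : HasExtensions G E) (hE' : ApproxBy G E)
    (hF : HasExtensions G F) (hF' : ApproxBy G F) (s : BiEmbedding G E F) {ε : ℝ} (hε : 0 < ε)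
    (V : Submodule 𝕜 E) [FiniteDimensional 𝕜 V] (W : Submodule 𝕜 F) [FiniteDimensional 𝕜 W] :
    ∃ (t : BiEmbedding G E F) (u : s.space →L[𝕜] t.space),
      (∀ x, ‖t.left (u x) - s.left x‖ ≤ ε * ‖x‖) ∧ (∀ x, ‖t.right (u x) - s.right x‖ ≤ ε * ‖x‖) ∧
      (∀ v ∈ V, ∃ y, ‖t.left y - v‖ ≤ ε * ‖v‖) ∧ ∀ w ∈ W, ∃ y, ‖t.right y - w‖ ≤ ε * ‖w‖ := by
  let ρ := min (ε / 3) 1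
  have hρ : 0 < ρ := by positivity
  have hρ1 : 3 * ρ ≤ ε := by linarith [min_le_left (ε / 3) 1]
  have hρ2 : ρ ≤ 1 := min_le_right _ _
  obtain ⟨Y, hY, α, β, u, hα, hβ, hW⟩ := exists_forth hE hF' s.mem s.left s.right hρ W
  obtain ⟨Z, hZ, β', α', w, hβ', hα', hV⟩ := exists_forth hF hE' hY β α hρ V
  have hu : ∀ x, ‖u x‖ ≤ 2 * ‖x‖ := fun x => by
    have h1 := hα x
    have h2 := norm_sub_norm_le (α (u x)) (s.left x)
    rw [LinearIsometry.norm_map, LinearIsometry.norm_map] at h2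
    nlinarith [norm_nonneg x]
  refine ⟨⟨Z, hZ, α', β'⟩, w.comp u, fun x => ?_, fun x => ?_, fun v hv => ?_, fun v hv => ?_⟩
  · have h1 := hα x
    have h2 := hα' (u x)
    have h3 := hu x
    calc ‖α' (w (u x)) - s.left x‖ ≤ ‖α' (w (u x)) - α (u x)‖ + ‖α (u x) - s.left x‖ :=
          norm_sub_le_norm_sub_add_norm_sub _ _ _
      _ ≤ ε * ‖x‖ := by nlinarith [norm_nonneg x]
  · have h1 := hβ x
    have h2 := hβ' (u x)
    have h3 := hu x
    calc ‖β' (w (u x)) - s.right x‖ ≤ ‖β' (w (u x)) - β (u x)‖ + ‖β (u x) - s.right x‖ :=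
          norm_sub_le_norm_sub_add_norm_sub _ _ _
      _ ≤ ε * ‖x‖ := by nlinarith [norm_nonneg x]
  · obtain ⟨y, hy⟩ := hV v hv
    exact ⟨y, hy.trans (by gcongr; linarith)⟩
  · obtain ⟨y, hy⟩ := hW v hv
    refine ⟨w y, ?_⟩
    have h2 := hβ' y
    have h3 : ‖y‖ ≤ 2 * ‖v‖ := by
      have h2 := norm_sub_norm_le (β y) v
      rw [LinearIsometry.norm_map] at h2
      nlinarith [norm_nonneg v]
    calc ‖β' (w y) - v‖ ≤ ‖β' (w y) - β y‖ + ‖β y - v‖ :=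
          norm_sub_le_norm_sub_add_norm_sub _ _ _
      _ ≤ ε * ‖v‖ := by nlinarith [norm_nonneg v]

variable [CompleteSpace E] [CompleteSpace F]

/-- The image of the relation given by limits along approximately coherent embeddings is dense. -/
theorem dense_limits {X : ℕ → FDSpace.{u} 𝕜} {u : ∀ n, X n →L[𝕜] X (n + 1)}
    {α : ∀ n, X n →ₗᵢ[𝕜] E} {β : ∀ n, X n →ₗᵢ[𝕜] F} {ε : ℝ} (hε : 0 ≤ ε) (hε1 : ε ≤ 1)
    (hα : ∀ n x, ‖α (n + 1) (u n x) - α n x‖ ≤ ε * (1 / 2) ^ (n + 2) * ‖x‖)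
    (hβ : ∀ n x, ‖β (n + 1) (u n x) - β n x‖ ≤ ε * (1 / 2) ^ (n + 2) * ‖x‖)
    {e : ℕ → E} (he : DenseRange e)
    (hd : ∀ n, ∀ l ≤ n, ∃ y, ‖α (n + 1) y - e l‖ ≤ ε * (1 / 2) ^ (n + 2) * ‖e l‖) :
    Dense {z : E | ∃ (w : F) (x : ∀ n, X n), Tendsto (fun n => α n (x n)) atTop (𝓝 z) ∧
      Tendsto (fun n => β n (x n)) atTop (𝓝 w)} := by
  rw [Metric.dense_iff]
  intro a r hr
  obtain ⟨l, hl⟩ := Metric.denseRange_iff.1 he a (r / 2) (by positivity)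
  -- One `‖e l‖` pays for approximating `e l` by `α (n + 1) y`, and two pay for passing to the
  -- limit, as `‖y‖ ≤ 2 * ‖e l‖`.
  have hlim : Tendsto (fun n : ℕ => (1 / 2 : ℝ) ^ n * (3 * ‖e l‖)) atTop (𝓝 0) := by
    simpa using (tendsto_pow_atTop_nhds_zero_of_lt_one (by norm_num) (by norm_num) :
      Tendsto (fun n : ℕ => (1 / 2 : ℝ) ^ n) atTop (𝓝 0)).mul_const (3 * ‖e l‖)
  obtain ⟨n, hn1, hn2⟩ := ((hlim.eventually (gt_mem_nhds (half_pos hr))).and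
    (eventually_ge_atTop l)).exists
  obtain ⟨y, hy⟩ := hd n l hn2
  obtain ⟨z, hz, hz'⟩ := exists_limit_orbitFrom hε hε1 hα (n + 1) y
  obtain ⟨w, hw, -⟩ := exists_limit_orbitFrom hε hε1 hβ (n + 1) y
  refine ⟨z, ?_, w, _, hz, hw⟩
  have hy1 : ‖α (n + 1) y - e l‖ ≤ (1 / 2) ^ n * ‖e l‖ := hy.trans (by
    have : ε * (1 / 2) ^ (n + 2) ≤ 1 * (1 / 2) ^ n :=
      mul_le_mul hε1 (pow_le_pow_of_le_one (by norm_num) (by norm_num) (by omega))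
        (by positivity) zero_le_one
    rw [one_mul] at this
    gcongr)
  have hp : ((1 : ℝ) / 2) ^ n ≤ 1 := pow_le_one₀ (by norm_num) (by norm_num)
  have hy2 : ‖y‖ ≤ 2 * ‖e l‖ := by
    have h2 := norm_sub_norm_le (α (n + 1) y) (e l)
    rw [LinearIsometry.norm_map] at h2
    nlinarith [norm_nonneg (e l)]
  have hz1 : ‖z - α (n + 1) y‖ ≤ (1 / 2) ^ n * (2 * ‖e l‖) := hz'.trans (by
    have : ε * (1 / 2) ^ (n + 1) ≤ 1 * (1 / 2) ^ n :=
      mul_le_mul hε1 (pow_le_pow_of_le_one (by norm_num) (by norm_num) (by omega))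
        (by positivity) zero_le_one
    rw [one_mul] at this
    gcongr)
  rw [Metric.mem_ball, dist_comm]
  calc dist a z ≤ dist a (e l) + dist (e l) z := dist_triangle _ _ _
    _ < r / 2 + r / 2 := by
      refine add_lt_add hl (lt_of_le_of_lt ?_ hn1)
      rw [dist_comm, dist_eq_norm]
      have := norm_sub_le_norm_sub_add_norm_sub z (α (n + 1) y) (e l)
      linarith
    _ = r := by ring

/-- The back-and-forth theorem. -/
theorem exists_linearIsometryEquiv_near (hE : HasExtensions G E) (hE' : ApproxBy G E)
    (hF : HasExtensions G F) (hF' : ApproxBy G F) [TopologicalSpace.SeparableSpace E]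
    [TopologicalSpace.SeparableSpace F] {X : FDSpace.{u} 𝕜} (hX : X ∈ G) (α₀ : X →ₗᵢ[𝕜] E)
    (β₀ : X →ₗᵢ[𝕜] F) {ε : ℝ} (hε : 0 < ε) :
    ∃ g : E ≃ₗᵢ[𝕜] F, ∀ x, ‖g (α₀ x) - β₀ x‖ ≤ ε * ‖x‖ := by
  let ρ := min (ε / 2) 1
  have hρ : 0 < ρ := by positivity
  have hρ1 : 2 * ρ ≤ ε := by linarith [min_le_left (ε / 2) 1]
  have hρ2 : ρ ≤ 1 := min_le_right _ _
  let e := TopologicalSpace.denseSeq E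
  let f := TopologicalSpace.denseSeq F
  obtain ⟨s, hs0, -, hs⟩ := exists_seq_of_step (S := BiEmbedding G E F) (fun _ _ => True)
    (fun n s t => ∃ u : s.space →L[𝕜] t.space,
      (∀ x, ‖t.left (u x) - s.left x‖ ≤ ρ * (1 / 2) ^ (n + 2) * ‖x‖) ∧
      (∀ x, ‖t.right (u x) - s.right x‖ ≤ ρ * (1 / 2) ^ (n + 2) * ‖x‖) ∧
      (∀ l ≤ n, ∃ y, ‖t.left y - e l‖ ≤ ρ * (1 / 2) ^ (n + 2) * ‖e l‖) ∧
      ∀ l ≤ n, ∃ y, ‖t.right y - f l‖ ≤ ρ * (1 / 2) ^ (n + 2) * ‖f l‖)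
    ⟨X, hX, α₀, β₀⟩ trivial (fun n s _ => by
      have : FiniteDimensional 𝕜 (Submodule.span 𝕜 (e '' Set.Iic n)) :=
        FiniteDimensional.span_of_finite 𝕜 ((Set.finite_Iic n).image e)
      have : FiniteDimensional 𝕜 (Submodule.span 𝕜 (f '' Set.Iic n)) :=
        FiniteDimensional.span_of_finite 𝕜 ((Set.finite_Iic n).image f)
      obtain ⟨t, u, h1, h2, h3, h4⟩ := exists_back_and_forth hE hE' hF hF' s
        (ε := ρ * (1 / 2) ^ (n + 2)) (by positivity) (Submodule.span 𝕜 (e '' Set.Iic n))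
        (Submodule.span 𝕜 (f '' Set.Iic n))
      exact ⟨t, trivial, u, h1, h2,
        fun l hl => h3 _ (Submodule.subset_span ⟨l, hl, rfl⟩),
        fun l hl => h4 _ (Submodule.subset_span ⟨l, hl, rfl⟩)⟩)
  choose u hα hβ hdE hdF using hs
  let α := fun n => (s n).left
  let β := fun n => (s n).right
  -- Pairs of limits of one sequence `x n`: both limits have norm `lim ‖x n‖`, so the relation is
  -- isometric.
  let Γ : Submodule 𝕜 (E × F) :=
    { carrier := {z | ∃ x : ∀ n, (s n).space, Tendsto (fun n => α n (x n)) atTop (𝓝 z.1) ∧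
        Tendsto (fun n => β n (x n)) atTop (𝓝 z.2)}
      add_mem' := by
        rintro z w ⟨x, h1, h2⟩ ⟨y, h3, h4⟩
        exact ⟨fun n => x n + y n, by simpa using h1.add h3, by simpa using h2.add h4⟩
      zero_mem' := ⟨fun n => 0, by simp, by simp⟩
      smul_mem' := by
        rintro c z ⟨x, h1, h2⟩
        exact ⟨fun n => c • x n, by simpa using h1.const_smul c, by simpa using h2.const_smul c⟩ }
  obtain ⟨g, hg⟩ := exists_linearIsometryEquiv_of_relation Γ
    (by
      rintro z ⟨x, h1, h2⟩
      have h1 := h1.norm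
      have h2 := h2.norm
      simp only [LinearIsometry.norm_map] at h1 h2
      exact tendsto_nhds_unique h1 h2)
    ((dense_limits hρ.le hρ2 hα hβ (TopologicalSpace.denseRange_denseSeq E) hdE).mono (by
      rintro z ⟨w, x, h⟩
      exact ⟨(z, w), ⟨x, h⟩, rfl⟩))
    ((dense_limits hρ.le hρ2 hβ hα (TopologicalSpace.denseRange_denseSeq F) hdF).mono (by
      rintro z ⟨w, x, h⟩
      exact ⟨(w, z), ⟨x, h.symm⟩, rfl⟩))
  have key : ∀ x : (s 0).space, ‖g ((s 0).left x) - (s 0).right x‖ ≤ ε * ‖x‖ := fun x => by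
    obtain ⟨a, ha, ha'⟩ := exists_limit_orbitFrom (X := fun n => (s n).space) (α := α) hρ.le hρ2 hα 0 x
    obtain ⟨b, hb, hb'⟩ := exists_limit_orbitFrom (X := fun n => (s n).space) (α := β) hρ.le hρ2 hβ 0 x
    have hab : g a = b := hg (a, b) ⟨_, ha, hb⟩
    have h1 : ‖g ((s 0).left x) - b‖ ≤ ρ * ‖x‖ := by
      rw [← hab, ← map_sub, g.norm_map, norm_sub_rev]
      simpa using ha'
    have h2 := norm_sub_le_norm_sub_add_norm_sub (g ((s 0).left x)) b ((s 0).right x)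
    have h3 : ‖b - (s 0).right x‖ ≤ ρ * ‖x‖ := by simpa using hb'
    nlinarith [norm_nonneg x]
  rw [hs0] at key
  exact ⟨g, key⟩

end BackForth

end FraisseBanach
namespace FraisseBanach

variable {𝕜 : Type v} [RCLike 𝕜]

/-! ### Auerbach bases and compactness of coordinate norms -/

section Auerbach

variable {X : Type u} [NormedAddCommGroup X] [NormedSpace 𝕜 X] {k : ℕ}

/-- Auerbach's lemma: unit vectors whose coordinate functionals have norm at most one. -/
theorem exists_auerbach_basis [FiniteDimensional 𝕜 X] (hk : Module.finrank 𝕜 X = k) :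
    ∃ b : Module.Basis (Fin k) 𝕜 X, (∀ i, ‖b i‖ ≤ 1) ∧
      ∀ a : Fin k → 𝕜, ‖a‖ ≤ ‖∑ i, a i • b i‖ := by
  classical
  have : ProperSpace X := FiniteDimensional.proper_rclike 𝕜 X
  let e := Module.finBasisOfFinrankEq 𝕜 X hk
  let K : Set (Fin k → X) := Set.univ.pi fun _ => Metric.closedBall 0 1
  have hK : IsCompact K := isCompact_univ_pi fun _ => isCompact_closedBall _ _
  have hcont : Continuous fun x : Fin k → X => ‖e.det x‖ := by
    have h1 : ∀ i, Continuous fun x : X => e.repr x i := fun i =>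
      (e.coord i).continuous_of_finiteDimensional
    simp only [e.det_apply]
    refine Continuous.norm (Continuous.matrix_det (continuous_matrix fun i j => ?_))
    exact (h1 i).comp (continuous_apply j)
  -- The Auerbach basis is a `k`-tuple in the unit ball with determinant of maximal modulus.
  obtain ⟨x, hxK, hmax⟩ := hK.exists_isMaxOn ⟨0, by simp [K, Set.mem_pi]⟩ hcont.continuousOn
  have hx1 : ∀ i, ‖x i‖ ≤ 1 := fun i => by simpa using hxK i trivial
  have hpos : 0 < ‖e.det x‖ := by
    let c : Fin k → 𝕜 := fun i => ((‖e i‖⁻¹ : ℝ) : 𝕜)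
    have h1 : (fun i => c i • e i) ∈ K := fun i _ => by
      simp only [mem_closedBall_zero_iff, norm_smul, c, RCLike.norm_ofReal, abs_inv, abs_norm]
      rw [inv_mul_cancel₀ (norm_ne_zero_iff.2 (e.ne_zero i))]
    refine lt_of_lt_of_le ?_ (hmax h1)
    have h2 : e.det (fun i => c i • e i) = (∏ i, c i) • e.det e := e.det.map_smul_univ c e
    change 0 < ‖e.det (fun i => c i • e i)‖
    rw [h2, e.det_self, norm_pos_iff, smul_eq_mul, mul_one, Finset.prod_ne_zero_iff]
    intro i _
    simpa [c] using e.ne_zero i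
  have hbound : ∀ (a : Fin k → 𝕜) (i : Fin k), ‖a i‖ ≤ ‖∑ j, a j • x j‖ := by
    intro a i
    -- Cramer's rule: replacing the `i`-th vector gives a functional with value `a i * det x` on the
    -- combination, and maximality bounds it by `‖det x‖` on the unit ball.
    let φ : X →ₗ[𝕜] 𝕜 := e.det.toMultilinearMap.toLinearMap x i
    have hφ : ∀ y, φ y = e.det (Function.update x i y) := fun y => rfl
    have h1 : φ (∑ j, a j • x j) = a i * e.det x := by
      rw [map_sum, Finset.sum_eq_single i]
      · rw [map_smul, hφ, Function.update_eq_self, smul_eq_mul]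
      · intro j _ hj
        rw [map_smul, hφ, e.det.map_update_self x hj.symm, smul_zero]
      · simp
    have h2 : ∀ y, ‖y‖ ≤ 1 → ‖φ y‖ ≤ ‖e.det x‖ := fun y hy => by
      have : Function.update x i y ∈ K := fun j _ => by
        by_cases hj : j = i
        · subst hj; simpa using hy
        · simpa [hj] using hx1 j
      exact hmax this
    set s := ∑ j, a j • x j
    by_cases hs : s = 0
    · rw [hs, map_zero] at h1
      have : a i = 0 := by
        rcases mul_eq_zero.1 h1.symm with h | h
        · exact h
        · rw [h, norm_zero] at hpos; exact absurd hpos (lt_irrefl _)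
      simp [this]
    · have hs' : 0 < ‖s‖ := norm_pos_iff.2 hs
      have h3 := h2 (((‖s‖⁻¹ : ℝ) : 𝕜) • s) (by
        rw [norm_smul, RCLike.norm_ofReal, abs_inv, abs_norm, inv_mul_cancel₀ hs'.ne'])
      rw [map_smul, norm_smul, RCLike.norm_ofReal, abs_inv, abs_norm, h1, norm_mul,
        inv_mul_le_iff₀ hs'] at h3
      exact le_of_mul_le_mul_right h3 hpos
  have hli : LinearIndependent 𝕜 x := Fintype.linearIndependent_iff.2 fun a ha i => by
    have := hbound a i
    rw [ha, norm_zero] at this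
    exact norm_le_zero_iff.1 this
  have hb : ⊤ ≤ Submodule.span 𝕜 (Set.range x) :=
    (hli.span_eq_top_of_card_eq_finrank' (by simp [hk])).ge
  refine ⟨Module.Basis.mk hli hb, fun i => by simpa using hx1 i, fun a => ?_⟩
  simp only [Module.Basis.mk_apply]
  exact (pi_norm_le_iff_of_nonneg (norm_nonneg _)).2 (hbound a)

/-- The norm of `X` in the coordinates given by `b`, on the unit ball of the coordinate space. -/
noncomputable def coordNorm (b : Fin k → X) :
    BoundedContinuousFunction (Metric.closedBall (0 : Fin k → 𝕜) 1) ℝ :=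
  BoundedContinuousFunction.mkOfCompact
    ⟨fun a => ‖∑ i, (a : Fin k → 𝕜) i • b i‖,
      (continuous_finsetSum _ fun i _ =>
        ((continuous_apply i).comp continuous_subtype_val).smul continuous_const).norm⟩

theorem coordNorm_apply (b : Fin k → X) (a : Metric.closedBall (0 : Fin k → 𝕜) 1) :
    coordNorm b a = ‖∑ i, (a : Fin k → 𝕜) i • b i‖ := rfl

theorem norm_sum_smul_le {b : Fin k → X} {r : ℝ} (hb : ∀ i, ‖b i‖ ≤ r) (a : Fin k → 𝕜) :
    ‖∑ i, a i • b i‖ ≤ k * (r * ‖a‖) := by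
  refine (norm_sum_le_of_le (f := fun i => a i • b i) Finset.univ (n := fun _ => r * ‖a‖)
    fun i _ => ?_).trans (by simp)
  rw [norm_smul, mul_comm]
  exact mul_le_mul (hb i) (norm_le_pi_norm a i) (norm_nonneg _) ((norm_nonneg _).trans (hb i))

theorem abs_norm_sum_sub_le {Y : Type*} [NormedAddCommGroup Y] [NormedSpace 𝕜 Y] (b : Fin k → X)
    (c : Fin k → Y) {r : ℝ}
    (h : ∀ a : Metric.closedBall (0 : Fin k → 𝕜) 1,
      |‖∑ i, (a : Fin k → 𝕜) i • b i‖ - ‖∑ i, (a : Fin k → 𝕜) i • c i‖| ≤ r) (a : Fin k → 𝕜) :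
    |‖∑ i, a i • b i‖ - ‖∑ i, a i • c i‖| ≤ r * ‖a‖ := by
  by_cases ha : a = 0
  · simp [ha]
  have ha' : 0 < ‖a‖ := norm_pos_iff.2 ha
  have hn : ‖((‖a‖⁻¹ : ℝ) : 𝕜)‖ = ‖a‖⁻¹ := by rw [RCLike.norm_ofReal, abs_inv, abs_norm]
  have h1 := h ⟨((‖a‖⁻¹ : ℝ) : 𝕜) • a, by
    rw [mem_closedBall_zero_iff, norm_smul, hn, inv_mul_cancel₀ ha'.ne']⟩
  simp only [Pi.smul_apply, smul_assoc, ← Finset.smul_sum, norm_smul, hn, ← mul_sub, abs_mul,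
    abs_inv, abs_norm] at h1
  rw [inv_mul_le_iff₀ ha'] at h1
  linarith

theorem abs_norm_sum_sub_le_dist {Y : Type u} [NormedAddCommGroup Y] [NormedSpace 𝕜 Y]
    (b : Fin k → X) (c : Fin k → Y) (a : Fin k → 𝕜) :
    |‖∑ i, a i • b i‖ - ‖∑ i, a i • c i‖| ≤
      dist (coordNorm (𝕜 := 𝕜) b) (coordNorm (𝕜 := 𝕜) c) * ‖a‖ :=
  abs_norm_sum_sub_le b c (fun a => by
    rw [← coordNorm_apply, ← coordNorm_apply, ← Real.dist_eq]
    exact BoundedContinuousFunction.dist_coe_le_dist a) a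

/-- Vectors whose norms are close to those of the vectors of a basis yield a `δ`-embedding. -/
theorem isDeltaEmb_constr {Y : Type u} [NormedAddCommGroup Y] [NormedSpace 𝕜 Y]
    [FiniteDimensional 𝕜 X] (b : Module.Basis (Fin k) 𝕜 X)
    (hb : ∀ a : Fin k → 𝕜, ‖a‖ ≤ ‖∑ i, a i • b i‖) (c : Fin k → Y) {δ : ℝ} (hδ : 0 < δ)
    (h : ∀ a : Fin k → 𝕜, |‖∑ i, a i • b i‖ - ‖∑ i, a i • c i‖| ≤ perturbRadius 0 δ * ‖a‖) :
    IsDeltaEmb δ (LinearMap.toContinuousLinearMap (b.constr 𝕜 c)) := by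
  refine isDeltaEmb_of_abs_le hδ fun x => ?_
  have e1 : ∑ i, b.equivFun x i • b i = x := b.sum_equivFun x
  have e2 : LinearMap.toContinuousLinearMap (b.constr 𝕜 c) x = ∑ i, b.equivFun x i • c i := by
    simp [Module.Basis.constr_apply_fintype]
  have h1 := h (b.equivFun x)
  have h2 := hb (b.equivFun x)
  rw [e1] at h1 h2
  rw [e2, abs_sub_comm]
  exact h1.trans (mul_le_mul_of_nonneg_left h2 (perturbRadius_pos le_rfl hδ).le)

end Auerbach

variable (𝕜) in
/-- The norms on `𝕜 ^ k` for which the unit vectors have norm at most one form a relatively compact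
set. -/
theorem isCompact_closure_coordNorm (k : ℕ) :
    IsCompact (closure {f : BoundedContinuousFunction (Metric.closedBall (0 : Fin k → 𝕜) 1) ℝ |
      ∃ (X : FDSpace.{u} 𝕜) (b : Fin k → X), (∀ i, ‖b i‖ ≤ 1) ∧ f = coordNorm b}) := by
  refine BoundedContinuousFunction.arzela_ascoli (Set.Icc 0 (k : ℝ)) isCompact_Icc _ ?_ ?_
  · rintro _ a ⟨X, b, hb, rfl⟩
    have ha : ‖(a : Fin k → 𝕜)‖ ≤ 1 := mem_closedBall_zero_iff.1 a.2
    rw [coordNorm_apply]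
    refine ⟨norm_nonneg _, (norm_sum_smul_le hb _).trans ?_⟩
    rw [one_mul]
    exact mul_le_of_le_one_right (Nat.cast_nonneg k) ha
  · refine (LipschitzWith.uniformEquicontinuous _ (k : ℝ≥0) ?_).equicontinuous
    rintro ⟨_, X, b, hb, rfl⟩
    refine LipschitzWith.of_dist_le_mul fun a a' => ?_
    change dist (coordNorm b a) (coordNorm b a') ≤ _
    rw [coordNorm_apply, coordNorm_apply, Real.dist_eq, Subtype.dist_eq, dist_eq_norm]
    refine (abs_norm_sub_norm_le _ _).trans ?_
    rw [← Finset.sum_sub_distrib]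
    simp only [← sub_smul]
    have := norm_sum_smul_le hb ((a : Fin k → 𝕜) - (a' : Fin k → 𝕜))
    simpa using this

/-- A nonempty class of finite-dimensional spaces has a countable subclass into which all its
members embed almost isometrically. -/
theorem exists_countable_dense (G : Set (FDSpace.{u} 𝕜)) (hG : G.Nonempty) :
    ∃ h : ℕ → FDSpace.{u} 𝕜, (∀ n, h n ∈ G) ∧ ∀ X ∈ G, ∀ ε : ℝ, 0 < ε →
      ∃ (n : ℕ) (T : X →L[𝕜] h n), IsDeltaEmb ε T := by
  have hk : ∀ k : ℕ, ∃ C : Set (FDSpace.{u} 𝕜), C.Countable ∧ C ⊆ G ∧ ∀ X ∈ G, X.dim = k →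
      ∀ ε : ℝ, 0 < ε → ∃ Y ∈ C, ∃ T : X →L[𝕜] Y, IsDeltaEmb ε T := by
    intro k
    let S : Set (BoundedContinuousFunction (Metric.closedBall (0 : Fin k → 𝕜) 1) ℝ) :=
      {f | ∃ X ∈ G, ∃ b : Fin k → X, (∀ i, ‖b i‖ ≤ 1) ∧ f = coordNorm b}
    have hS : TopologicalSpace.IsSeparable S :=
      (isCompact_closure_coordNorm.{u} 𝕜 k).isSeparable.mono
        (Set.Subset.trans (by rintro f ⟨X, _, h⟩; exact ⟨X, h⟩) subset_closure)
    -- The dense set is taken inside `S`, so that each of its norms comes from a member of `G`.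
    obtain ⟨t, htS, ht, hd⟩ := hS.exists_countable_dense_subset
    choose Y hY c hc hcn using htS
    refine ⟨Set.range fun f : t => Y f.2, @Set.countable_range _ _ ht.to_subtype _, ?_, fun X hX hXk ε hε => ?_⟩
    · rintro _ ⟨f, rfl⟩
      exact hY f.2
    -- Only the source needs an Auerbach basis; for the target, vectors with nearly the same
    -- coordinate norm suffice.
    · obtain ⟨b, hb1, hb2⟩ := exists_auerbach_basis (𝕜 := 𝕜) (X := X) hXk
      obtain ⟨f, hf, hdist⟩ := Metric.mem_closure_iff.1
        (hd (show coordNorm b ∈ S from ⟨X, hX, b, hb1, rfl⟩)) _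
        (perturbRadius_pos le_rfl hε)
      refine ⟨Y hf, ⟨⟨f, hf⟩, rfl⟩, _, isDeltaEmb_constr b hb2 (c hf) hε fun a => ?_⟩
      refine (abs_norm_sum_sub_le_dist _ _ _).trans ?_
      rw [← hcn hf]
      gcongr
  choose C hC hCG hCd using hk
  have hne : (⋃ k, C k).Nonempty := by
    obtain ⟨X, hX⟩ := hG
    obtain ⟨Y, hY, -⟩ := hCd X.dim X hX rfl 1 one_pos
    exact ⟨Y, Set.mem_iUnion.2 ⟨_, hY⟩⟩
  obtain ⟨h, hh⟩ := (Set.countable_iUnion hC).exists_eq_range hne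
  refine ⟨h, fun n => ?_, fun X hX ε hε => ?_⟩
  · exact Set.iUnion_subset hCG (hh ▸ Set.mem_range_self n)
  · obtain ⟨Y, hY, T, hT⟩ := hCd X.dim X hX rfl ε hε
    obtain ⟨n, rfl⟩ : Y ∈ Set.range h := hh ▸ Set.mem_iUnion.2 ⟨_, hY⟩
    exact ⟨n, T, hT⟩

end FraisseBanach
namespace FraisseBanach

variable {𝕜 : Type v} [RCLike 𝕜]

/-! ### Inductive limits of isometric embeddings -/

section Limit

variable {X : ℕ → FDSpace.{u} 𝕜} (I : ∀ n, X n →ₗᵢ[𝕜] X (n + 1))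

/-- The eventually coherent sequences. -/
def coherentSubmodule : Submodule 𝕜 (∀ n, X n) where
  carrier := {x | ∀ᶠ n in atTop, x (n + 1) = I n (x n)}
  add_mem' := by
    intro x y hx hy
    filter_upwards [hx, hy] with n h1 h2
    simp [h1, h2]
  zero_mem' := by simp
  smul_mem' := by
    intro c x hx
    filter_upwards [hx] with n h1
    simp [h1]

/-- The eventually coherent sequences, with the seminorm that is the eventual norm of the terms. -/
def CoherentSeq : Type u := coherentSubmodule I

noncomputable instance : AddCommGroup (CoherentSeq I) :=
  inferInstanceAs (AddCommGroup (coherentSubmodule I))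

noncomputable instance : Module 𝕜 (CoherentSeq I) :=
  inferInstanceAs (Module 𝕜 (coherentSubmodule I))

variable {I}

theorem CoherentSeq.exists_norm (x : CoherentSeq I) : ∃ r : ℝ, ∀ᶠ n in atTop, ‖x.1 n‖ = r := by
  obtain ⟨N, hN⟩ := eventually_atTop.1 (show ∀ᶠ n in atTop, x.1 (n + 1) = I n (x.1 n) from x.2)
  refine ⟨‖x.1 N‖, eventually_atTop.2 ⟨N, fun n hn => ?_⟩⟩
  induction n, hn using Nat.le_induction with
  | base => rfl
  | succ n hn ih => rw [hN n hn, LinearIsometry.norm_map, ih]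

noncomputable instance : Norm (CoherentSeq I) := ⟨fun x => x.exists_norm.choose⟩

theorem CoherentSeq.eventually_norm (x : CoherentSeq I) : ∀ᶠ n in atTop, ‖x.1 n‖ = ‖x‖ :=
  x.exists_norm.choose_spec

theorem CoherentSeq.core : SeminormedSpace.Core 𝕜 (CoherentSeq I) where
  norm_nonneg x := by
    obtain ⟨n, hn⟩ := x.eventually_norm.exists
    exact hn ▸ norm_nonneg _
  norm_smul c x := by
    obtain ⟨n, h1, h2⟩ := (x.eventually_norm.and (c • x).eventually_norm).exists
    rw [← h1, ← h2, ← norm_smul]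
    rfl
  norm_triangle x y := by
    obtain ⟨n, h1, h2, h3⟩ := (x.eventually_norm.and
      (y.eventually_norm.and (x + y).eventually_norm)).exists
    rw [← h1, ← h2, ← h3]
    exact norm_add_le _ _

noncomputable instance : SeminormedAddCommGroup (CoherentSeq I) :=
  SeminormedAddCommGroup.ofCore (𝕜 := 𝕜) CoherentSeq.core

noncomputable instance : NormedSpace 𝕜 (CoherentSeq I) :=
  ⟨fun c x => (CoherentSeq.core.norm_smul c x).le⟩

variable (I) in
/-- The coherent sequence generated by a vector. -/
noncomputable def CoherentSeq.of (n : ℕ) : X n →ₗᵢ[𝕜] CoherentSeq I where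
  toFun x := ⟨orbitFrom (fun n => (I n).toContinuousLinearMap) n x,
    eventually_atTop.2 ⟨n, fun _ hm => orbitFrom_succ _ hm x⟩⟩
  map_add' x y := Subtype.ext (funext fun m => orbitFrom_add _ n x y m)
  map_smul' c x := Subtype.ext (funext fun m => orbitFrom_smul _ n c x m)
  norm_map' x := by
    let y : CoherentSeq I := ⟨orbitFrom (fun n => (I n).toContinuousLinearMap) n x,
      eventually_atTop.2 ⟨n, fun _ hm => orbitFrom_succ _ hm x⟩⟩
    change ‖y‖ = ‖x‖
    obtain ⟨m, h1, h2⟩ := (y.eventually_norm.and (eventually_ge_atTop n)).exists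
    rw [← h1]
    clear h1
    change ‖orbitFrom (fun n => (I n).toContinuousLinearMap) n x m‖ = ‖x‖
    induction m, h2 using Nat.le_induction with
    | base => rw [orbitFrom_self]
    | succ m hm ih =>
      rw [← ih, orbitFrom_succ _ hm]
      exact (I m).norm_map _

theorem CoherentSeq.norm_sub_eq_zero {x y : CoherentSeq I} {N : ℕ}
    (h : ∀ n ≥ N, x.1 n = y.1 n) : ‖x - y‖ = 0 := by
  obtain ⟨m, h1, h2⟩ := ((x - y).eventually_norm.and (eventually_ge_atTop N)).exists
  rw [← h1]
  change ‖x.1 m - y.1 m‖ = 0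
  rw [h m h2, sub_self, norm_zero]

theorem eq_orbitFrom_of_coherent {x : ∀ n, X n} {N : ℕ} (h : ∀ n ≥ N, x (n + 1) = I n (x n))
    {m : ℕ} (hm : N ≤ m) :
    x m = orbitFrom (fun n => (I n).toContinuousLinearMap) N (x N) m := by
  induction m, hm using Nat.le_induction with
  | base => rw [orbitFrom_self]
  | succ m hm ih => rw [orbitFrom_succ _ hm, ← ih, h m hm]; rfl

variable (I) in
/-- Every sequence of isometric embeddings has an inductive limit in Banach spaces. -/
theorem exists_inductiveLimit :
    ∃ (E : Type u) (_ : NormedAddCommGroup E) (_ : NormedSpace 𝕜 E) (_ : CompleteSpace E),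
      IsInductiveLimit X I E := by
  -- The completion is Hausdorff, so it also identifies sequences that eventually agree, which are
  -- at distance zero.
  refine ⟨UniformSpace.Completion (CoherentSeq I), inferInstance, inferInstance, inferInstance,
    fun n => UniformSpace.Completion.toComplₗᵢ.comp (CoherentSeq.of I n), fun n => ?_, ?_⟩
  · ext x
    change ((CoherentSeq.of I (n + 1) (I n x) : CoherentSeq I) :
      UniformSpace.Completion (CoherentSeq I)) = (CoherentSeq.of I n x : CoherentSeq I)
    rw [← sub_eq_zero, ← UniformSpace.Completion.coe_sub, ← norm_eq_zero,
      UniformSpace.Completion.norm_coe]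
    refine CoherentSeq.norm_sub_eq_zero (N := n + 1) fun m hm => ?_
    change orbitFrom _ (n + 1) (I n x) m = orbitFrom _ n x m
    rw [eq_orbitFrom_of_coherent (I := I)
      (x := orbitFrom (fun n => (I n).toContinuousLinearMap) n x) (N := n + 1)
      (fun l hl => orbitFrom_succ _ (by omega) x) hm, orbitFrom_succ _ le_rfl, orbitFrom_self]
    rfl
  · refine (UniformSpace.Completion.denseRange_coe (α := CoherentSeq I)).mono ?_
    rintro _ ⟨x, rfl⟩
    obtain ⟨N, hN⟩ := eventually_atTop.1
      (show ∀ᶠ n in atTop, x.1 (n + 1) = I n (x.1 n) from x.2)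
    refine Set.mem_iUnion.2 ⟨N, x.1 N, ?_⟩
    change ((CoherentSeq.of I N (x.1 N) : CoherentSeq I) :
      UniformSpace.Completion (CoherentSeq I)) = x
    rw [← sub_eq_zero, ← UniformSpace.Completion.coe_sub, ← norm_eq_zero,
      UniformSpace.Completion.norm_coe]
    exact CoherentSeq.norm_sub_eq_zero (N := N) fun m hm => (eq_orbitFrom_of_coherent hN hm).symm

end Limit

/-! ### A sequence absorbing its extensions -/

section FraisseSequence

variable {G : Set (FDSpace.{u} 𝕜)}

/-- A sequence of members of `G` along which countably many tasks for each member are carried out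
whenever they can be. -/
theorem exists_sequence_of_tasks {τ : Type*} [Denumerable τ] {X₀ : FDSpace.{u} 𝕜} (hX₀ : X₀ ∈ G)
    (D : ∀ (A : FDSpace.{u} 𝕜) (_ : τ) (B : FDSpace.{u} 𝕜), (A →ₗᵢ[𝕜] B) → Prop) :
    ∃ (X : ℕ → FDSpace.{u} 𝕜) (I : ∀ n, X n →ₗᵢ[𝕜] X (n + 1)), (∀ n, X n ∈ G) ∧
      ∀ n t, ∃ (m : ℕ) (_ : n ≤ m) (g : X n →ₗᵢ[𝕜] X m),
        (∀ x, g x = orbitFrom (fun n => (I n).toContinuousLinearMap) n x m) ∧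
        ((∃ H ∈ G, ∃ j : X m →ₗᵢ[𝕜] H, D (X n) t H (j.comp g)) →
          D (X n) t (X (m + 1)) ((I m).comp g)) := by
  classical
  -- The state at stage `m` is the current space with its history: entry `l ≤ m` is the `l`-th space
  -- with its composite embedding into the current one. Entries `l > m` are placeholders, reset at
  -- each step so that entry `m + 1` becomes the new space with the identity.
  let S := Σ B : FDSpace.{u} 𝕜, (ℕ → Σ A : FDSpace.{u} 𝕜, A →ₗᵢ[𝕜] B)
  obtain ⟨f, hf0, hfG, hf⟩ := exists_seq_of_step (S := S) (fun _ s => s.1 ∈ G)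
    (fun m s s' => ∃ j : s.1 →ₗᵢ[𝕜] s'.1,
      (∀ l ≤ m, s'.2 l = ⟨(s.2 l).1, j.comp (s.2 l).2⟩) ∧
      (∀ l, m < l → s'.2 l = ⟨s'.1, LinearIsometry.id⟩) ∧
      ((∃ H ∈ G, ∃ j' : s.1 →ₗᵢ[𝕜] H,
        D (s.2 m.unpair.1).1 (Denumerable.ofNat τ m.unpair.2) H (j'.comp (s.2 m.unpair.1).2)) →
          D (s.2 m.unpair.1).1 (Denumerable.ofNat τ m.unpair.2) s'.1 (j.comp (s.2 m.unpair.1).2)))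
    ⟨X₀, fun _ => ⟨X₀, LinearIsometry.id⟩⟩ hX₀ (by
      intro m s hs
      obtain ⟨H, hH, j, hj⟩ : ∃ H ∈ G, ∃ j : s.1 →ₗᵢ[𝕜] H, ((∃ H ∈ G, ∃ j' : s.1 →ₗᵢ[𝕜] H,
        D (s.2 m.unpair.1).1 (Denumerable.ofNat τ m.unpair.2) H (j'.comp (s.2 m.unpair.1).2)) →
          D (s.2 m.unpair.1).1 (Denumerable.ofNat τ m.unpair.2) H (j.comp (s.2 m.unpair.1).2)) := by
        -- Stage `m` codes a pair of a space and a task. If some extension performs the task, take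
        -- it; otherwise keep the space unchanged.
        by_cases h : ∃ H ∈ G, ∃ j' : s.1 →ₗᵢ[𝕜] H,
          D (s.2 m.unpair.1).1 (Denumerable.ofNat τ m.unpair.2) H (j'.comp (s.2 m.unpair.1).2)
        · obtain ⟨H, hH, j, hj⟩ := h
          exact ⟨H, hH, j, fun _ => hj⟩
        · exact ⟨s.1, hs, LinearIsometry.id, fun h' => absurd h' h⟩
      refine ⟨⟨H, fun l => if l ≤ m then ⟨(s.2 l).1, j.comp (s.2 l).2⟩ else
        ⟨H, LinearIsometry.id⟩⟩, hH, j, fun l hl => by simp [hl], fun l hl => ?_, hj⟩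
      simp [not_le.2 hl])
  choose I hI1 hI2 hI3 using hf
  have key : ∀ m n, n ≤ m → ∃ g : (f n).1 →ₗᵢ[𝕜] (f m).1, (f m).2 n = ⟨(f n).1, g⟩ ∧
      ∀ x, g x = orbitFrom (X := fun n => (f n).1) (fun n => (I n).toContinuousLinearMap) n x m := by
    intro m n hnm
    induction m with
    | zero =>
      obtain rfl : n = 0 := by omega
      refine ⟨LinearIsometry.id, ?_, fun x => (orbitFrom_self (X := fun n => (f n).1) _ 0 x).symm⟩
      rw [hf0]
    | succ m ih =>
      rcases Nat.lt_or_ge m n with h | h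
      · obtain rfl : n = m + 1 := by omega
        exact ⟨LinearIsometry.id, hI2 m _ h, fun x =>
          (orbitFrom_self (X := fun n => (f n).1) _ (m + 1) x).symm⟩
      · obtain ⟨g, hg, hg'⟩ := ih h
        refine ⟨(I m).comp g, ?_, fun x => ?_⟩
        · rw [hI1 m n h, hg]
        · rw [orbitFrom_succ _ h, ← hg']
          rfl
  refine ⟨fun n => (f n).1, I, hfG, fun n t => ?_⟩
  -- A pair is never smaller than its first entry, so the `n`-th space is already in the history
  -- when its task is due.
  have hn : n ≤ Nat.pair n (Encodable.encode t) := Nat.left_le_pair n _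
  obtain ⟨g, hg, hg'⟩ := key _ n hn
  refine ⟨Nat.pair n (Encodable.encode t), hn, g, hg', ?_⟩
  have h3 := hI3 (Nat.pair n (Encodable.encode t))
  rw [Nat.unpair_pair, Denumerable.ofNat_encode] at h3
  revert h3
  generalize (f (Nat.pair n (Encodable.encode t))).2 n = q at hg ⊢
  subst hg
  exact id

/-- In an amalgamation class there is a sequence of isometric embeddings that absorbs all its
extensions approximately. -/
theorem exists_fraisse_sequence (hG : IsAmalgamationClass G) :
    ∃ (X : ℕ → FDSpace.{u} 𝕜) (I : ∀ n, X n →ₗᵢ[𝕜] X (n + 1)), (∀ n, X n ∈ G) ∧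
      ∀ n, ∀ H ∈ G, ∀ (j : X n →ₗᵢ[𝕜] H) (ε : ℝ), 0 < ε →
        ∃ (m : ℕ) (_ : n ≤ m) (T : H →L[𝕜] X m), IsDeltaEmb ε T ∧ ∀ x,
          ‖T (j x) - orbitFrom (fun n => (I n).toContinuousLinearMap) n x m‖ ≤ ε * ‖x‖ := by
  obtain ⟨⟨X₀, hX₀, -⟩, hA⟩ := hG
  obtain ⟨h, hh, hd⟩ := exists_countable_dense G ⟨X₀, hX₀⟩
  have hsep : ∀ A B : FDSpace.{u} 𝕜, TopologicalSpace.SeparableSpace (A →L[𝕜] B) := fun A B => by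
    have : ProperSpace (A →L[𝕜] B) := FiniteDimensional.proper_rclike 𝕜 _
    infer_instance
  let d : ∀ (A : FDSpace.{u} 𝕜) (l i : ℕ), A →L[𝕜] h l := fun A l i =>
    haveI := hsep A (h l)
    TopologicalSpace.denseSeq (A →L[𝕜] h l) i
  -- Task `(l, i, p)`: embed `h l` isometrically so that it agrees with `f` along the `i`-th map of
  -- a dense sequence, up to `1 / (p + 1)`. Countably many such tasks replace all extensions of `A`.
  let D : ∀ (A : FDSpace.{u} 𝕜) (_ : ℕ × ℕ × ℕ) (B : FDSpace.{u} 𝕜), (A →ₗᵢ[𝕜] B) → Prop :=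
    fun A t B f => ∃ i : h t.1 →ₗᵢ[𝕜] B, ∀ x,
      ‖i (d A t.1 t.2.1 x) - f x‖ ≤ 1 / ((t.2.2 : ℝ) + 1) * ‖x‖
  obtain ⟨X, I, hX, hT⟩ := exists_sequence_of_tasks hX₀ D
  refine ⟨X, I, hX, fun n H hH j ε hε => ?_⟩
  obtain ⟨p, hp⟩ := exists_nat_one_div_lt (half_pos hε)
  obtain ⟨δ, hδ, hδA⟩ := hA (X n).dim (1 / ((p : ℝ) + 1)) (by positivity)
  let σ := min (δ / 2) ε
  have hσ : 0 < σ := by positivity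
  have hσδ : σ < δ := lt_of_le_of_lt (min_le_left _ _) (by linarith)
  obtain ⟨l, R, hR⟩ := hd H hH σ hσ
  let ρ := min (ε / 2) (perturbRadius σ δ)
  have hρ : 0 < ρ := lt_min (by positivity) (perturbRadius_pos hσ.le hσδ)
  obtain ⟨i, hi⟩ : ∃ i, ∀ x, ‖d (X n) l i x - R (j x)‖ ≤ ρ * ‖x‖ := by
    have := hsep (X n) (h l)
    obtain ⟨i, hi⟩ := Metric.denseRange_iff.1
      (TopologicalSpace.denseRange_denseSeq (X n →L[𝕜] h l)) (R.comp j.toContinuousLinearMap) ρ hρ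
    refine ⟨i, fun x => ?_⟩
    rw [dist_comm, dist_eq_norm] at hi
    exact (ContinuousLinearMap.le_opNorm (TopologicalSpace.denseSeq (X n →L[𝕜] h l) i -
      R.comp j.toContinuousLinearMap) x).trans (by gcongr)
  have hdi : IsDeltaEmb δ (d (X n) l i) := (hR.comp_isometry j).perturb hσ.le hσδ fun x =>
    (hi x).trans (by gcongr; exact min_le_right _ _)
  obtain ⟨m, hnm, g, hg, hD⟩ := hT n (l, i, p)
  -- The task is feasible at whatever stage `m` it is due, by amalgamating `d (X n) l i` with the
  -- embedding `g` of `X n` into `X m`.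
  obtain ⟨a, ha⟩ := hD (by
    obtain ⟨K, hK, a, b, hab⟩ := hδA (X n) (hX n) rfl (h l) (hh l) (X m) (hX m) (d (X n) l i)
      g.toContinuousLinearMap hdi (isDeltaEmb_isometry hδ.le g)
    refine ⟨K, hK, b, a, fun x => ?_⟩
    exact (ContinuousLinearMap.le_opNorm (a.toContinuousLinearMap.comp (d (X n) l i) -
      b.toContinuousLinearMap.comp g.toContinuousLinearMap) x).trans (by gcongr))
  refine ⟨m + 1, hnm.trans m.le_succ, a.toContinuousLinearMap.comp R,
    (hR.isometry_comp a).mono hσ.le (min_le_right _ _), fun x => ?_⟩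
  rw [orbitFrom_succ _ hnm, ← hg]
  change ‖a (R (j x)) - I m (g x)‖ ≤ _
  have h1 := ha x
  have h2 : ‖a (R (j x)) - a (d (X n) l i x)‖ ≤ ρ * ‖x‖ := by
    rw [← map_sub, LinearIsometry.norm_map, norm_sub_rev]
    exact hi x
  have h3 := norm_sub_le_norm_sub_add_norm_sub (a (R (j x))) (a (d (X n) l i x)) (I m (g x))
  have h4 : ρ ≤ ε / 2 := min_le_left _ _
  have h5 : ‖a (d (X n) l i x) - I m (g x)‖ ≤ 1 / ((p : ℝ) + 1) * ‖x‖ := h1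
  nlinarith [norm_nonneg x]

end FraisseSequence

end FraisseBanach
namespace FraisseBanach

variable {𝕜 : Type v} [RCLike 𝕜]

/-! ### From extensions and amalgamation to transitivity -/

section Transitivity

variable {G : Set (FDSpace.{u} 𝕜)} {E : Type u} [NormedAddCommGroup E] [NormedSpace 𝕜 E]

/-- Amalgamation in `G` yields approximate transitivity of the isometry group. -/
theorem Amalgamates.epsTransitive [CompleteSpace E] [TopologicalSpace.SeparableSpace E] (hE : HasExtensions G E)
    (hE' : ApproxBy G E) {X : FDSpace.{u} 𝕜} {δ δ' ε ε' : ℝ} (h0 : 0 ≤ δ)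
    (hδ : δ < δ') (hε : ε' < ε) (hA : Amalgamates G X δ' ε') :
    EpsTransitive (𝕜 := 𝕜) X E δ ε := by
  intro γ η hγ hη
  let V := LinearMap.range γ.toLinearMap ⊔ LinearMap.range η.toLinearMap
  have hδ' : 0 < 1 + δ' := by linarith
  -- Besides `ε'`, the final estimate has two errors `σ` and two errors `σ * (1 + δ')`; together
  -- these are `(ε - ε') / 2`.
  let σ := (ε - ε') / (2 * (4 + 2 * δ'))
  have hσ : 0 < σ := div_pos (by linarith) (by linarith)
  have hσ' : σ * (4 + 2 * δ') = (ε - ε') / 2 := by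
    have : 4 + 2 * δ' ≠ 0 := by linarith
    simp only [σ]; field_simp
  let ρ := min σ (perturbRadius δ δ')
  have hρ : 0 < ρ := lt_min hσ (perturbRadius_pos h0 hδ)
  obtain ⟨Y, hY, j, S, hS⟩ := hE' V inferInstance (ρ / (1 + δ)) (by positivity)
  have lift : ∀ α : X →L[𝕜] E, IsDeltaEmb δ α → LinearMap.range α.toLinearMap ≤ V →
      ∃ α' : X →L[𝕜] Y, IsDeltaEmb δ' α' ∧ ∀ x, ‖j (α' x) - α x‖ ≤ σ * ‖x‖ := by
    intro α hα hV
    let α' : X →L[𝕜] Y := S.comp (α.codRestrict V fun x => hV ⟨x, rfl⟩)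
    have h1 : ∀ x, ‖j (α' x) - α x‖ ≤ ρ * ‖x‖ := fun x => by
      refine (hS ⟨α x, hV ⟨x, rfl⟩⟩).trans ?_
      calc ρ / (1 + δ) * ‖α x‖ ≤ ρ / (1 + δ) * ((1 + δ) * ‖x‖) := by
            gcongr; exact (hα x).2
        _ = ρ * ‖x‖ := by field_simp
    refine ⟨α', fun x => ?_, fun x => (h1 x).trans (by gcongr; exact min_le_left _ _)⟩
    have h2 : IsDeltaEmb δ' (j.toContinuousLinearMap.comp α') :=
      hα.perturb h0 hδ fun x => (h1 x).trans (by gcongr; exact min_le_right _ _)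
    simpa using h2 x
  obtain ⟨γ', hγ', hγj⟩ := lift γ hγ le_sup_left
  obtain ⟨η', hη', hηj⟩ := lift η hη le_sup_right
  -- Two copies of `Y` are amalgamated over `X`. Then `θ` places `H` in `E` with `θ ∘ b ≈ j`, and
  -- `g` moves `j` near `θ ∘ a`, so that `g γ ≈ g j γ' ≈ θ a γ' ≈ θ b η' ≈ j η' ≈ η`.
  obtain ⟨H, hH, a, b, hab⟩ := hA Y hY Y hY γ' η' hγ' hη'
  obtain ⟨δ₁, hδ₁, hext⟩ := hE Y.dim σ hσ
  obtain ⟨θ, hθ⟩ := hext Y hY rfl H hH b.toContinuousLinearMap j.toContinuousLinearMap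
    (isDeltaEmb_isometry hδ₁.le b) (isDeltaEmb_isometry hδ₁.le j)
  obtain ⟨g, hg⟩ := exists_linearIsometryEquiv_near hE hE' hE hE' hY j (θ.comp a) hσ
  refine ⟨g, lt_of_le_of_lt (ContinuousLinearMap.opNorm_le_bound _ (M := (ε + ε') / 2) ?_
    fun x => ?_) (by linarith)⟩
  · have := (norm_nonneg _).trans hab
    linarith
  have e1 : ‖g (γ x) - g (j (γ' x))‖ ≤ σ * ‖x‖ := by
    rw [← map_sub, g.norm_map, norm_sub_rev]
    exact hγj x
  have hγn := (hγ' x).2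
  have hηn := (hη' x).2
  have e2 : ‖g (j (γ' x)) - θ (a (γ' x))‖ ≤ σ * ((1 + δ') * ‖x‖) :=
    (hg (γ' x)).trans (by gcongr)
  have e3 : ‖θ (a (γ' x)) - θ (b (η' x))‖ ≤ ε' * ‖x‖ := by
    rw [← map_sub, θ.norm_map]
    exact (ContinuousLinearMap.le_opNorm (a.toContinuousLinearMap.comp γ' -
      b.toContinuousLinearMap.comp η') x).trans (by gcongr)
  have e4 : ‖θ (b (η' x)) - j (η' x)‖ ≤ σ * ((1 + δ') * ‖x‖) :=
    (hθ (η' x)).trans (by gcongr)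
  have e5 := hηj x
  change ‖g (γ x) - η x‖ ≤ _
  calc ‖g (γ x) - η x‖ = ‖(g (γ x) - g (j (γ' x))) + (g (j (γ' x)) - θ (a (γ' x)))
        + (θ (a (γ' x)) - θ (b (η' x))) + (θ (b (η' x)) - j (η' x)) + (j (η' x) - η x)‖ := by
        congr 1; abel
    _ ≤ σ * ‖x‖ + σ * ((1 + δ') * ‖x‖) + ε' * ‖x‖ + σ * ((1 + δ') * ‖x‖) + σ * ‖x‖ :=
        norm_add_le_of_le (norm_add_le_of_le (norm_add_le_of_le (norm_add_le_of_le e1 e2) e3) e4) e5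
    _ = (σ * (4 + 2 * δ') + ε') * ‖x‖ := by ring
    _ = (ε + ε') / 2 * ‖x‖ := by rw [hσ']; ring

/-- Almost isometric extensions can be corrected to isometric ones. -/
theorem hasExtensions_of_almost [CompleteSpace E]
    (h : ∀ (k : ℕ) (ε : ℝ), 0 < ε → ∃ δ : ℝ, 0 < δ ∧ ∀ X ∈ G, X.dim = k → ∀ Y ∈ G,
      ∀ (γ : X →L[𝕜] Y) (η : X →L[𝕜] E), IsDeltaEmb δ γ → IsDeltaEmb δ η → ∀ δ' : ℝ, 0 < δ' →
        ∃ T : Y →L[𝕜] E, IsDeltaEmb δ' T ∧ ∀ x, ‖T (γ x) - η x‖ ≤ ε * ‖x‖) :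
    HasExtensions G E := by
  intro k ε hε
  obtain ⟨δ, hδ, H⟩ := h k (ε / 2) (by positivity)
  refine ⟨δ, hδ, fun X hX hk Y hY γ η hγ hη => ?_⟩
  -- The total correction to `T₀` is at most `C`; evaluated on `γ x`, of norm at most `(1 + δ) *
  -- ‖x‖`, it costs `ε / 2`.
  let C := ε / (2 * (1 + δ))
  have hC : 0 < C := by positivity
  choose d hd H' using fun n : ℕ => h Y.dim (C / 2 / 2 ^ n) (by positivity)
  let r : ℕ → ℝ := fun n => min (d n) ((1 / 2) ^ n)
  have hr : ∀ n, 0 < r n := fun n => lt_min (hd n) (by positivity)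
  obtain ⟨T₀, hT₀, hT₀'⟩ := H X hX hk Y hY γ η hγ hη (r 0) (hr 0)
  obtain ⟨T, hT0, hT, hTs⟩ := exists_seq_of_step (fun n (T : Y →L[𝕜] E) => IsDeltaEmb (r n) T)
    (fun n T T' => dist T T' ≤ C / 2 / 2 ^ n) T₀ hT₀ (fun n T hT => by
      -- Extending `T` along the identity of `Y` replaces it by a nearby map with better distortion.
      obtain ⟨T', h1, h2⟩ := H' n Y hY rfl Y hY (ContinuousLinearMap.id 𝕜 Y) T
        (isDeltaEmb_isometry (hd n).le LinearIsometry.id) (hT.mono (hr n).le (min_le_left _ _))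
        (r (n + 1)) (hr _)
      refine ⟨T', h1, ?_⟩
      rw [dist_comm, dist_eq_norm]
      exact ContinuousLinearMap.opNorm_le_bound _ (by positivity) h2)
  obtain ⟨T', hT'⟩ := cauchySeq_tendsto_of_complete (cauchySeq_of_le_geometric_two hTs)
  have hdist := dist_le_of_le_geometric_two_of_tendsto₀ hTs hT'
  rw [hT0, dist_comm, dist_eq_norm] at hdist
  have hr0 : Tendsto r atTop (𝓝 0) :=
    squeeze_zero (fun n => (hr n).le) (fun n => min_le_right _ _)
      (tendsto_pow_atTop_nhds_zero_of_lt_one (by norm_num) (by norm_num))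
  obtain ⟨j, hj⟩ := exists_isometry_of_tendsto hr0 hT (γ' := T') fun y =>
    ((ContinuousLinearMap.apply 𝕜 E y).continuous.tendsto T').comp hT'
  refine ⟨j, fun x => ?_⟩
  rw [hj]
  have h1 : ‖T' (γ x) - T₀ (γ x)‖ ≤ C * ((1 + δ) * ‖x‖) :=
    (ContinuousLinearMap.le_opNorm (T' - T₀) (γ x)).trans (by
      gcongr
      exact (hγ x).2)
  have h2 : C * ((1 + δ) * ‖x‖) = ε / 2 * ‖x‖ := by
    simp only [C]; field_simp
  have h3 := norm_sub_le_norm_sub_add_norm_sub (T' (γ x)) (T₀ (γ x)) (η x)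
  have h4 := hT₀' x
  linarith

/-- Extending the zero map embeds every member of `G`. -/
theorem HasExtensions.classLE_age (hG : HasZero G) (hE : HasExtensions G E) :
    ClassLE G (Age 𝕜 E) := by
  refine classLE_age_of_isometry fun Y hY => ?_
  obtain ⟨Z, hZ, hZ0⟩ := hG
  obtain ⟨δ, hδ, H⟩ := hE Z.dim 1 one_pos
  have : Subsingleton Z := Module.finrank_zero_iff.1 hZ0
  obtain ⟨j, -⟩ := H Z hZ rfl Y hY 0 0 (fun x => by simp [Subsingleton.elim x 0])
    (fun x => by simp [Subsingleton.elim x 0])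
  exact ⟨j⟩

end Transitivity

/-! ### The limit of an absorbing sequence -/

section FraisseLimit

variable {G : Set (FDSpace.{u} 𝕜)} {X : ℕ → FDSpace.{u} 𝕜} {I : ∀ n, X n →ₗᵢ[𝕜] X (n + 1)}
  {E : Type u} [NormedAddCommGroup E] [NormedSpace 𝕜 E] {J : ∀ n, X n →ₗᵢ[𝕜] E}

theorem limit_orbitFrom (hJ : ∀ n, (J (n + 1)).comp (I n) = J n) (n : ℕ) (x : X n) {m : ℕ}
    (hm : n ≤ m) : J m (orbitFrom (fun n => (I n).toContinuousLinearMap) n x m) = J n x := by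
  induction m, hm using Nat.le_induction with
  | base => rw [orbitFrom_self]
  | succ m hm ih =>
    rw [orbitFrom_succ _ hm, ← ih, ← hJ m]
    rfl

theorem exists_near_limit (hJ : ∀ n, (J (n + 1)).comp (I n) = J n)
    (hd : Dense (⋃ n, Set.range (J n))) {ι : Type*} [Finite ι] (b : ι → E) {ε : ℝ} (hε : 0 < ε) :
    ∃ N, ∀ l, ∃ y : X N, ‖J N y - b l‖ ≤ ε := by
  have h1 : ∀ l, ∃ (n : ℕ) (y : X n), ‖J n y - b l‖ ≤ ε := fun l => by
    obtain ⟨z, hz, hzd⟩ := Metric.dense_iff.1 hd (b l) ε hε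
    obtain ⟨n, y, rfl⟩ := Set.mem_iUnion.1 hzd
    rw [Metric.mem_ball, dist_eq_norm] at hz
    exact ⟨n, y, hz.le⟩
  choose n y hy using h1
  obtain ⟨N, hN⟩ := (Set.finite_range n).bddAbove
  refine ⟨N, fun l => ⟨orbitFrom (fun n => (I n).toContinuousLinearMap) (n l) (y l) N, ?_⟩⟩
  rw [limit_orbitFrom hJ _ _ (hN ⟨l, rfl⟩)]
  exact hy l

theorem exists_approx_in_limit (hJ : ∀ n, (J (n + 1)).comp (I n) = J n)
    (hd : Dense (⋃ n, Set.range (J n))) (V : Submodule 𝕜 E) [FiniteDimensional 𝕜 V] {ε : ℝ}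
    (hε : 0 < ε) : ∃ (N : ℕ) (S : V →L[𝕜] X N), ∀ v : V, ‖J N (S v) - v‖ ≤ ε * ‖v‖ := by
  obtain ⟨ρ, hρ, H⟩ := exists_approx_of_near_basis V hε
  obtain ⟨N, hN⟩ := exists_near_limit hJ hd (fun l => (Module.finBasis 𝕜 V l : E)) hρ
  exact ⟨N, H _ _ hN⟩

/-- The limit of a sequence that absorbs its extensions has the extension property. -/
theorem hasExtensions_limit [CompleteSpace E] (hG : IsAmalgamationClass G) (hX : ∀ n, X n ∈ G)
    (hF : ∀ n, ∀ H ∈ G, ∀ (j : X n →ₗᵢ[𝕜] H) (ε : ℝ), 0 < ε →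
        ∃ (m : ℕ) (_ : n ≤ m) (T : H →L[𝕜] X m), IsDeltaEmb ε T ∧ ∀ x,
          ‖T (j x) - orbitFrom (fun n => (I n).toContinuousLinearMap) n x m‖ ≤ ε * ‖x‖)
    (hJ : ∀ n, (J (n + 1)).comp (I n) = J n) (hd : Dense (⋃ n, Set.range (J n))) :
    HasExtensions G E := by
  refine hasExtensions_of_almost fun k ε hε => ?_
  obtain ⟨δ, hδ, hA⟩ := hG.2 k (ε / 4) (by positivity)
  have hδ2 : δ / 2 < δ := by linarith
  refine ⟨δ / 2, half_pos hδ, fun A hAG hk Y hY γ η hγ hη δ' hδ' => ?_⟩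
  let ρ := min (ε / 4) (perturbRadius (δ / 2) δ)
  have hρ : 0 < ρ := lt_min (by positivity) (perturbRadius_pos (by positivity) hδ2)
  obtain ⟨N, S, hS⟩ := exists_approx_in_limit hJ hd (LinearMap.range η.toLinearMap)
    (ε := ρ / (1 + δ / 2)) (by positivity)
  let η' : A →L[𝕜] X N := S.comp (η.codRestrict _ fun x => ⟨x, rfl⟩)
  have h1 : ∀ x, ‖J N (η' x) - η x‖ ≤ ρ * ‖x‖ := fun x => by
    refine (hS ⟨η x, ⟨x, rfl⟩⟩).trans ?_
    calc ρ / (1 + δ / 2) * ‖η x‖ ≤ ρ / (1 + δ / 2) * ((1 + δ / 2) * ‖x‖) := by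
          gcongr; exact (hη x).2
      _ = ρ * ‖x‖ := by field_simp
  have hη' : IsDeltaEmb δ η' := fun x => by
    have h2 : IsDeltaEmb δ ((J N).toContinuousLinearMap.comp η') :=
      hη.perturb (by positivity) hδ2 fun x => (h1 x).trans (by gcongr; exact min_le_right _ _)
    simpa using h2 x
  -- With `η` pulled back to `X N`, the amalgam `H` extends both `Y` and `X N`; the sequence absorbs
  -- `H` into a later `X m`, and this places `Y` in `E`.
  obtain ⟨H, hH, a, b, hab⟩ := hA A hAG hk Y hY (X N) (hX N) γ η'
    (hγ.mono (by positivity) hδ2.le) hη'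
  let σ := min δ' (min 1 (ε / 4 / (1 + δ)))
  have hσ : 0 < σ := by positivity
  have hσ1 : σ ≤ 1 := (min_le_right _ _).trans (min_le_left _ _)
  have hσ2 : σ * (1 + δ) ≤ ε / 4 := by
    rw [← le_div_iff₀ (by positivity)]
    exact (min_le_right _ _).trans (min_le_right _ _)
  obtain ⟨m, hm, T, hT, hTb⟩ := hF N H hH b σ hσ
  have hT' := hT.isometry_comp (J m)
  refine ⟨((J m).toContinuousLinearMap.comp T).comp a.toContinuousLinearMap,
    (hT'.comp_isometry a).mono hσ.le (min_le_left _ _), fun x => ?_⟩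
  change ‖J m (T (a (γ x))) - η x‖ ≤ _
  have hx := norm_nonneg x
  have e1 : ‖J m (T (a (γ x))) - J m (T (b (η' x)))‖ ≤ 2 * (ε / 4 * ‖x‖) := by
    rw [← map_sub, ← map_sub, LinearIsometry.norm_map]
    refine (hT _).2.trans ?_
    have : ‖a (γ x) - b (η' x)‖ ≤ ε / 4 * ‖x‖ :=
      (ContinuousLinearMap.le_opNorm (a.toContinuousLinearMap.comp γ -
        b.toContinuousLinearMap.comp η') x).trans (by gcongr)
    exact mul_le_mul (by linarith) this (norm_nonneg _) (by norm_num)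
  have e2 : ‖J m (T (b (η' x))) - J N (η' x)‖ ≤ ε / 4 * ‖x‖ := by
    rw [← limit_orbitFrom hJ N (η' x) hm, ← map_sub, LinearIsometry.norm_map]
    refine (hTb _).trans ?_
    calc σ * ‖η' x‖ ≤ σ * ((1 + δ) * ‖x‖) := by gcongr; exact (hη' x).2
      _ = σ * (1 + δ) * ‖x‖ := by ring
      _ ≤ ε / 4 * ‖x‖ := by gcongr
  have e3 : ‖J N (η' x) - η x‖ ≤ ε / 4 * ‖x‖ :=
    (h1 x).trans (by gcongr; exact min_le_left _ _)
  calc ‖J m (T (a (γ x))) - η x‖ = ‖(J m (T (a (γ x))) - J m (T (b (η' x))))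
        + (J m (T (b (η' x))) - J N (η' x)) + (J N (η' x) - η x)‖ := by congr 1; abel
    _ ≤ 2 * (ε / 4 * ‖x‖) + ε / 4 * ‖x‖ + ε / 4 * ‖x‖ :=
        norm_add_le_of_le (norm_add_le_of_le e1 e2) e3
    _ = ε * ‖x‖ := by ring

theorem separableSpace_limit (hd : Dense (⋃ n, Set.range (J n))) :
    TopologicalSpace.SeparableSpace E := by
  have h1 : TopologicalSpace.IsSeparable (⋃ n, Set.range (J n)) :=
    TopologicalSpace.IsSeparable.iUnion fun n => by
      have : ProperSpace (X n) := FiniteDimensional.proper_rclike 𝕜 _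
      exact TopologicalSpace.isSeparable_range (J n).continuous
  have h2 := h1.closure
  rw [hd.closure_eq] at h2
  exact TopologicalSpace.isSeparable_univ_iff.1 h2

end FraisseLimit

/-! ### Uniqueness, existence and dimension of the limit -/

section Uniqueness

variable {G : Set (FDSpace.{u} 𝕜)}

/-- The back-and-forth needs one member of `G` to start from; the bracket condition at `⊥` supplies
it. -/
theorem isometric_of_isGFraisse {E F : Type u} [NormedAddCommGroup E] [NormedSpace 𝕜 E]
    [CompleteSpace E] [NormedAddCommGroup F] [NormedSpace 𝕜 F] [CompleteSpace F]
    [TopologicalSpace.SeparableSpace E] [TopologicalSpace.SeparableSpace F]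
    (hE : IsGFraisse G E) (hF : IsGFraisse G F) (hE' : InBracket G E) (hF' : InBracket G F) :
    Isometric 𝕜 E F := by
  obtain ⟨-, ⟨X, hX, -⟩, -⟩ := hE' ⊥ inferInstance 1 one_pos
  obtain ⟨α⟩ := exists_isometry_of_classLE_age hE.1 hX
  obtain ⟨β⟩ := exists_isometry_of_classLE_age hF.1 hX
  obtain ⟨g, -⟩ := exists_linearIsometryEquiv_near hE.hasExtensions hE'.approxBy hF.hasExtensions
    hF'.approxBy hX α β one_pos
  exact ⟨g⟩

theorem InBracket.of_isometric {E F : Type u} [NormedAddCommGroup E] [NormedSpace 𝕜 E]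
    [NormedAddCommGroup F] [NormedSpace 𝕜 F] (h : InBracket G E) (e : Isometric 𝕜 E F) :
    InBracket G F :=
  let ⟨e⟩ := e
  (h.approxBy.of_isometric e).inBracket

theorem isModulus_modulusStar {w : ℕ → ℝ≥0 → ℝ≥0} (hw : IsModulus w) :
    IsModulus (modulusStar w) := by
  intro k
  obtain ⟨hm, h0, hc⟩ := hw k
  have hbdd : ∀ δ : ℝ≥0, BddBelow (Set.range fun δ' : Set.Ioi δ => w k δ') := fun δ =>
    OrderBot.bddBelow _
  have hle : ∀ δ δ' : ℝ≥0, δ < δ' → modulusStar w k δ ≤ w k δ' := fun δ δ' h =>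
    ciInf_le (hbdd δ) ⟨δ', h⟩
  have hmono : Monotone (modulusStar w k) := fun a b hab =>
    le_ciInf fun δ' => hle a δ' (lt_of_le_of_lt hab δ'.2)
  have hlim : ∀ r : ℝ≥0, 0 < r → ∃ d : ℝ≥0, 0 < d ∧ w k d < r := fun r hr => by
    have h1 : ∀ᶠ d in 𝓝 (0 : ℝ≥0), w k d < r := hc.eventually (gt_mem_nhds (by rwa [h0]))
    obtain ⟨d, h2, h3⟩ := ((h1.filter_mono nhdsWithin_le_nhds).and
      (self_mem_nhdsWithin (a := (0 : ℝ≥0)) (s := Set.Ioi 0))).exists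
    exact ⟨d, h3, h2⟩
  have hz : modulusStar w k 0 = 0 := by
    refine le_antisymm (le_of_forall_pos_le_add fun r hr => ?_) bot_le
    obtain ⟨d, hd, hd'⟩ := hlim r hr
    rw [zero_add]
    exact (hle 0 d hd).trans hd'.le
  refine ⟨hmono, hz, ?_⟩
  rw [ContinuousAt, hz]
  refine tendsto_order.2 ⟨fun a ha => absurd ha not_lt_bot, fun r hr => ?_⟩
  obtain ⟨d, hd, hd'⟩ := hlim r hr
  filter_upwards [gt_mem_nhds hd] with x hx
  exact (hle x d hx).trans_lt hd'

/-- Existence of the limit of an amalgamation class. -/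
theorem exists_fraisseLimit (hG : IsAmalgamationClass G) :
    ∃ (E : Type u) (_ : NormedAddCommGroup E) (_ : NormedSpace 𝕜 E) (_ : CompleteSpace E),
      IsFraisseLimit G E ∧
      (∀ w : ℕ → ℝ≥0 → ℝ≥0, HasAmalgamationModulus G w →
        HasGFraisseModulus G E (modulusStar w)) ∧
      ∃ (X : ℕ → FDSpace.{u} 𝕜) (I : ∀ n, X n →ₗᵢ[𝕜] X (n + 1)),
        (∀ n, X n ∈ G) ∧ IsInductiveLimit X I E := by
  obtain ⟨X, I, hX, hF⟩ := exists_fraisse_sequence hG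
  obtain ⟨E, hE1, hE2, hE3, J, hJ, hd⟩ := exists_inductiveLimit I
  have hext : HasExtensions G E := hasExtensions_limit hG hX hF hJ hd
  have happ : ApproxBy G E := fun V hV ε hε => by
    obtain ⟨N, S, hS⟩ := exists_approx_in_limit hJ hd V hε
    exact ⟨X N, hX N, J N, S, hS⟩
  have hsep : TopologicalSpace.SeparableSpace E := separableSpace_limit hd
  have hfr : IsGFraisse G E := by
    refine ⟨hext.classLE_age hG.1, fun k ε hε => ?_⟩
    obtain ⟨δ, hδ, H⟩ := hG.2 k (ε / 2) (by positivity)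
    exact ⟨δ / 2, by positivity, fun A hA hk => (H A hA hk).epsTransitive hext happ
      (by positivity) (by linarith) (by linarith)⟩
  refine ⟨E, hE1, hE2, hE3, ⟨hsep, hfr, happ.inBracket, ?_⟩, fun w hw => ?_, X, I, hX, J, hJ, hd⟩
  · intro F _ _ _ _ hF1 hF2
    exact isometric_of_isGFraisse hfr hF1 happ.inBracket hF2
  · refine ⟨isModulus_modulusStar hw.1, fun k δ ε hε A hA hk => ?_⟩
    -- Pulling `δ`-embeddings back into a member of `G` worsens `δ` slightly, so amalgamation is
    -- needed at some `δ' > δ`. The infimum over such `δ'` is `ϖ*`.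
    have hlt : modulusStar w k δ < modulusStar w k δ + ⟨ε / 2, by positivity⟩ :=
      lt_add_of_pos_right _ (show (0 : ℝ) < ε / 2 by positivity)
    obtain ⟨⟨δ', hδ'⟩, hw'⟩ := exists_lt_of_ciInf_lt hlt
    have hw2 : (w k δ' : ℝ) < modulusStar w k δ + ε / 2 := hw'
    refine (hw.2.2 k δ' (ε / 2) (lt_of_le_of_lt bot_le hδ') (by positivity) A hA
      hk).epsTransitive hext happ δ.2 (show (δ : ℝ) < δ' from hδ') ?_
    linarith

/-- An `n`-dimensional subspace of `E` is near one of the same dimension inside a copy of a member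
of `G`, which thus has dimension at least `n`. Conversely, members of `G` embed in `E`. -/
theorem IsFraisseLimit.infinite_dimensional_iff {E : Type u} [NormedAddCommGroup E]
    [NormedSpace 𝕜 E] [CompleteSpace E] (h : IsFraisseLimit G E) :
    ¬ FiniteDimensional 𝕜 E ↔ ∀ n : ℕ, ∃ X ∈ G, n ≤ X.dim := by
  constructor
  · intro hE n
    obtain ⟨V, hV⟩ : ∃ V : Submodule 𝕜 E, FiniteDimensional 𝕜 V ∧ Module.finrank 𝕜 V = n := by
      have h1 : (n : Cardinal) ≤ Module.rank 𝕜 E :=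
        (Cardinal.natCast_lt_aleph0).le.trans (not_lt.1 fun h => hE (Module.rank_lt_aleph0_iff.1 h))
      obtain ⟨s, hs, hli⟩ := exists_finset_linearIndependent_of_le_rank h1
      refine ⟨Submodule.span 𝕜 (s : Set E), FiniteDimensional.span_finset 𝕜 s, ?_⟩
      rw [finrank_span_finset_eq_card hli, hs]
    have := hV.1
    obtain ⟨Y, ⟨X, hX, ⟨e⟩⟩, Z, hZ, hdim, -⟩ := h.bracket V hV.1 1 one_pos
    refine ⟨X, hX, ?_⟩
    have : FiniteDimensional 𝕜 Y := e.toLinearEquiv.finiteDimensional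
    rw [← hV.2, ← hdim]
    exact (Submodule.finrank_mono hZ).trans e.toLinearEquiv.finrank_eq.ge
  · intro H hE
    obtain ⟨X, hX, hn⟩ := H (Module.finrank 𝕜 E + 1)
    obtain ⟨i⟩ := exists_isometry_of_classLE_age h.fraisse.1 hX
    have : X.dim ≤ _ := LinearMap.finrank_le_finrank_of_injective (f := i.toLinearMap) i.injective
    omega

end Uniqueness

end FraisseBanach
namespace FraisseBanach

variable {𝕜 : Type v} [RCLike 𝕜]

/-! ### Banach–Mazur distance and `δ`-embeddings -/

section BanachMazur

variable {X Y : FDSpace.{u} 𝕜}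

theorem one_le_iInf_norm_mul_norm_symm [Nontrivial X] (h : X.dim = Y.dim) :
    1 ≤ ⨅ T : X ≃L[𝕜] Y, ‖(T : X →L[𝕜] Y)‖ * ‖(T.symm : Y →L[𝕜] X)‖ := by
  have : Nonempty (X ≃L[𝕜] Y) := ⟨ContinuousLinearEquiv.ofFinrankEq h⟩
  exact le_ciInf fun T => T.one_le_norm_mul_norm_symm

/-- A `δ`-embedding between spaces of the same dimension bounds their distance. -/
theorem abs_dBM_le (h : X.dim = Y.dim) {δ : ℝ} (h0 : 0 ≤ δ) {T : X →L[𝕜] Y}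
    (hT : IsDeltaEmb δ T) : |dBM X Y| ≤ 2 * Real.log (1 + δ) := by
  have hlog : 0 ≤ Real.log (1 + δ) := Real.log_nonneg (by linarith)
  -- In dimension zero the products of norms are `0` instead of at least `1`; the value `Real.log 0
  -- = 0` covers this case.
  rcases subsingleton_or_nontrivial X with hs | hs
  · have : ∀ T : X ≃L[𝕜] Y, ‖(T : X →L[𝕜] Y)‖ * ‖(T.symm : Y →L[𝕜] X)‖ = 0 := fun T => by
      rw [Subsingleton.elim (T : X →L[𝕜] Y) 0, norm_zero, zero_mul]
    have h1 : dBM X Y = 0 := by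
      simp only [dBM, this, Real.iInf_const_zero, Real.log_zero]
    rw [h1, abs_zero]
    positivity
  · let e : X ≃L[𝕜] Y :=
      (LinearMap.linearEquivOfInjective T.toLinearMap (hT.injective h0) h).toContinuousLinearEquiv
    have he : ∀ x, e x = T x := fun x => rfl
    have h1 : ‖(e : X →L[𝕜] Y)‖ ≤ 1 + δ :=
      ContinuousLinearMap.opNorm_le_bound _ (by positivity) fun x => (hT x).2
    have h2 : ‖(e.symm : Y →L[𝕜] X)‖ ≤ 1 + δ :=
      ContinuousLinearMap.opNorm_le_bound _ (by positivity) fun y => by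
        have := (hT (e.symm y)).1
        rw [← he, e.apply_symm_apply, one_div_mul_eq_div, div_le_iff₀ (by positivity)] at this
        rw [mul_comm]
        exact this
    have h3 := one_le_iInf_norm_mul_norm_symm h
    have h4 : ⨅ T : X ≃L[𝕜] Y, ‖(T : X →L[𝕜] Y)‖ * ‖(T.symm : Y →L[𝕜] X)‖ ≤ (1 + δ) ^ 2 := by
      refine (ciInf_le ⟨0, ?_⟩ e).trans ?_
      · rintro _ ⟨T, rfl⟩
        positivity
      · rw [sq]
        exact mul_le_mul h1 h2 (norm_nonneg _) (by positivity)
    rw [dBM, abs_of_nonneg (Real.log_nonneg h3)]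
    refine (Real.log_le_log (by linarith) h4).trans (le_of_eq ?_)
    rw [Real.log_pow]
    norm_num

/-- Spaces of the same dimension at small distance have `δ`-embeddings. -/
theorem exists_isDeltaEmb_of_dBM_lt (h : X.dim = Y.dim) {δ : ℝ} (h0 : 0 < δ)
    (hd : dBM X Y < Real.log (1 + δ)) : ∃ T : X →L[𝕜] Y, IsDeltaEmb δ T := by
  rcases subsingleton_or_nontrivial X with hs | hs
  · exact ⟨0, fun x => by simp [Subsingleton.elim x 0]⟩
  · have h3 := one_le_iInf_norm_mul_norm_symm h
    have h4 := (Real.log_lt_log_iff (by linarith) (by linarith)).1 hd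
    have : Nonempty (X ≃L[𝕜] Y) := ⟨ContinuousLinearEquiv.ofFinrankEq h⟩
    obtain ⟨T, hT⟩ := exists_lt_of_ciInf_lt h4
    have hpos : 0 < ‖(T : X →L[𝕜] Y)‖ := T.norm_pos
    -- After normalisation `T` is a contraction, and the lower bound carries the whole distortion
    -- `‖T‖ * ‖T⁻¹‖ < 1 + δ`.
    refine ⟨((‖(T : X →L[𝕜] Y)‖⁻¹ : ℝ) : 𝕜) • (T : X →L[𝕜] Y), fun x => ?_⟩
    have hn : ‖(((‖(T : X →L[𝕜] Y)‖⁻¹ : ℝ) : 𝕜) • (T : X →L[𝕜] Y)) x‖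
        = ‖(T : X →L[𝕜] Y)‖⁻¹ * ‖T x‖ := by
      rw [smul_apply, norm_smul, RCLike.norm_ofReal, abs_inv, abs_norm]
      rfl
    rw [hn]
    constructor
    · rw [one_div_mul_eq_div, div_le_iff₀ (by linarith), inv_mul_eq_div, div_mul_eq_mul_div,
        le_div_iff₀ hpos]
      have h5 : ‖x‖ ≤ ‖(T.symm : Y →L[𝕜] X)‖ * ‖T x‖ := by
        simpa using (T.symm : Y →L[𝕜] X).le_opNorm (T x)
      calc ‖x‖ * ‖(T : X →L[𝕜] Y)‖
          ≤ ‖(T.symm : Y →L[𝕜] X)‖ * ‖T x‖ * ‖(T : X →L[𝕜] Y)‖ := by gcongr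
        _ = ‖T x‖ * (‖(T : X →L[𝕜] Y)‖ * ‖(T.symm : Y →L[𝕜] X)‖) := by ring
        _ ≤ ‖T x‖ * (1 + δ) := by gcongr
    · rw [inv_mul_le_iff₀ hpos]
      have h6 : ‖T x‖ ≤ ‖(T : X →L[𝕜] Y)‖ * ‖x‖ := (T : X →L[𝕜] Y).le_opNorm x
      refine h6.trans ?_
      gcongr
      exact le_mul_of_one_le_left (norm_nonneg _) (by linarith)

/-- Spaces of the same dimension with `δ`-embeddings for arbitrarily small `δ` are isometric. -/
theorem isometric_of_isDeltaEmb (h : X.dim = Y.dim) {δ : ℕ → ℝ} (hδ0 : ∀ n, 0 ≤ δ n)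
    (hδ : Tendsto δ atTop (𝓝 0)) (T : ℕ → X →L[𝕜] Y) (hT : ∀ n, IsDeltaEmb (δ n) (T n)) :
    Isometric 𝕜 X Y := by
  have : ProperSpace (X →L[𝕜] Y) := FiniteDimensional.proper_rclike 𝕜 _
  obtain ⟨r, hr⟩ := hδ.bddAbove_range
  have hb : ∀ n, T n ∈ Metric.closedBall (0 : X →L[𝕜] Y) (1 + r) := fun n => by
    have hrn : δ n ≤ r := hr ⟨n, rfl⟩
    rw [mem_closedBall_zero_iff]
    refine ContinuousLinearMap.opNorm_le_bound _ (by linarith [hδ0 n]) fun x =>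
      ((hT n x).2).trans (by gcongr)
  obtain ⟨T', -, φ, hφ, hlim⟩ := (isCompact_closedBall _ _).tendsto_subseq hb
  obtain ⟨i, -⟩ := exists_isometry_of_tendsto (hδ.comp hφ.tendsto_atTop) (fun n => hT (φ n))
    (γ' := T') fun x => ((ContinuousLinearMap.apply 𝕜 Y x).continuous.tendsto T').comp hlim
  exact ⟨i.toLinearIsometryEquiv h⟩

end BanachMazur

/-! ### The Fraïssé correspondence -/

section Correspondence

variable {G H : Set (FDSpace.{u} 𝕜)} {E : Type u} [NormedAddCommGroup E] [NormedSpace 𝕜 E]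

theorem EpsTransitive.of_isometric {X Y : FDSpace.{u} 𝕜} {δ ε : ℝ}
    (h : EpsTransitive (𝕜 := 𝕜) Y E δ ε) (e : Isometric 𝕜 X Y) :
    EpsTransitive (𝕜 := 𝕜) X E δ ε := by
  obtain ⟨e⟩ := e
  intro γ η hγ hη
  obtain ⟨g, hg⟩ := h _ _ (hγ.comp_isometry e.symm.toLinearIsometry)
    (hη.comp_isometry e.symm.toLinearIsometry)
  refine ⟨g, lt_of_le_of_lt ?_ hg⟩
  refine ContinuousLinearMap.opNorm_le_bound _ (norm_nonneg _) fun x => ?_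
  have := ContinuousLinearMap.le_opNorm (g.toLinearIsometry.toContinuousLinearMap.comp
    (γ.comp e.symm.toLinearIsometry.toContinuousLinearMap) -
    η.comp e.symm.toLinearIsometry.toContinuousLinearMap) (e x)
  simpa using this

theorem IsGFraisse.of_classLE (h : IsGFraisse G E) (hHE : ClassLE H (Age 𝕜 E))
    (hHG : ClassLE H G) : IsGFraisse H E := by
  refine ⟨hHE, fun k ε hε => ?_⟩
  obtain ⟨δ, hδ, hG⟩ := h.2 k ε hε
  refine ⟨δ, hδ, fun X hX hk => ?_⟩
  obtain ⟨Y, hY, ⟨e⟩⟩ := hHG X hX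
  exact (hG Y hY (e.toLinearEquiv.finrank_eq.symm.trans hk)).of_isometric ⟨e⟩

theorem approxBy_of_age_classLE (h : ClassLE (Age 𝕜 E) G) : ApproxBy G E := by
  intro V hV ε hε
  obtain ⟨Y, hY, ⟨e⟩⟩ := h ⟨V⟩ ⟨V, hV, rfl⟩
  let e' : V ≃ₗᵢ[𝕜] Y := e
  refine ⟨Y, hY, V.subtypeₗᵢ.comp e'.symm.toLinearIsometry,
    e'.toLinearIsometry.toContinuousLinearMap, fun v => ?_⟩
  have h0 : (V.subtypeₗᵢ.comp e'.symm.toLinearIsometry)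
      (e'.toLinearIsometry.toContinuousLinearMap v) = v :=
    congrArg Subtype.val (e'.symm_apply_apply v)
  rw [h0, sub_self, norm_zero]
  positivity

/-- For a hereditary compact class `G`, a space approximated by `G` has its age in `G`. -/
theorem age_classLE (hH : IsHereditary G) (hC : IsBMCompact G) (hE : ApproxBy G E) :
    ClassLE (Age 𝕜 E) G := by
  rintro _ ⟨V, hV, rfl⟩
  let δ : ℕ → ℝ := fun n => 1 / ((n : ℝ) + 1)
  have hδ : ∀ n, 0 < δ n := fun n => by positivity
  have hδ0 : Tendsto δ atTop (𝓝 0) := tendsto_one_div_add_atTop_nhds_zero_nat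
  have h1 : ∀ n, ∃ Z ∈ G, Z.dim = Module.finrank 𝕜 V ∧ ∃ R : V →L[𝕜] Z, IsDeltaEmb (δ n) R := by
    intro n
    obtain ⟨Y, hY, j, S, hS⟩ := hE V hV _ (perturbRadius_pos le_rfl (hδ n))
    have hS' : IsDeltaEmb (δ n) S := fun x => by
      have : IsDeltaEmb (δ n) (j.toContinuousLinearMap.comp S) :=
        isDeltaEmb_of_near_isometry (hδ n) V.subtypeₗᵢ hS
      simpa using this x
    let W := LinearMap.range S.toLinearMap
    -- Heredity replaces the member `Y` by a member of the same dimension as `V`, as compactness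
    -- requires.
    obtain ⟨Z, hZ, ⟨e⟩⟩ := hH Y hY ⟨W⟩ ⟨W.subtypeₗᵢ⟩
    let e' : W ≃ₗᵢ[𝕜] Z := e
    have hdim : Module.finrank 𝕜 W = Module.finrank 𝕜 V :=
      LinearMap.finrank_range_of_inj (hS'.injective (hδ n).le)
    let S' : V →L[𝕜] W := S.codRestrict W fun x => ⟨x, rfl⟩
    have hS'' : IsDeltaEmb (δ n) S' := fun x => hS' x
    exact ⟨Z, hZ, e'.toLinearEquiv.finrank_eq.symm.trans hdim, _,
      hS''.isometry_comp e'.toLinearIsometry⟩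
  choose Z hZ hZd R hR using h1
  obtain ⟨Y, hY, hYd, φ, hφ, hlim⟩ := hC _ Z fun n => ⟨hZ n, hZd n⟩
  -- Taking `m ≥ n` gives `δ (φ m) ≤ δ n`, so both factors of the composite `V → Z (φ m) → Y` are `δ
  -- n`-embeddings.
  have h2 : ∀ n, ∃ m, n ≤ m ∧ ∃ T : Z (φ m) →L[𝕜] Y, IsDeltaEmb (δ n) T := fun n => by
    obtain ⟨m, hm, hnm⟩ := ((hlim.eventually (gt_mem_nhds
      (Real.log_pos (by linarith [hδ n] : 1 < 1 + δ n)))).and (eventually_ge_atTop n)).exists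
    exact ⟨m, hnm, exists_isDeltaEmb_of_dBM_lt ((hZd _).trans hYd.symm) (hδ n) hm⟩
  choose m hm T hT using h2
  refine ⟨Y, hY, isometric_of_isDeltaEmb (X := ⟨V⟩) (δ := fun n => (1 + δ n) * (1 + δ n) - 1)
    hYd.symm (fun n => by nlinarith [hδ n]) ?_ (fun n => (T n).comp (R (φ (m n)))) fun n => ?_⟩
  · simpa using ((hδ0.const_add 1).mul (hδ0.const_add 1)).sub_const 1
  · refine IsDeltaEmb.comp (hδ n).le ((hR _).mono (hδ _).le ?_) (hT n)
    simp only [δ]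
    have : (n : ℝ) ≤ φ (m n) := by
      exact_mod_cast (hm n).trans (hφ.le_apply)
    gcongr

theorem isHereditary_of_classEquiv (h : ClassEquiv G (Age 𝕜 E)) : IsHereditary G := by
  rintro X hX Y ⟨i⟩
  obtain ⟨j⟩ := exists_isometry_of_classLE_age h.1 hX
  let f := j.comp i
  let W := LinearMap.range f.toLinearMap
  obtain ⟨Z, hZ, ⟨e⟩⟩ := h.2 ⟨W⟩ ⟨W, inferInstance, rfl⟩
  exact ⟨Z, hZ, ⟨f.equivRange.trans e⟩⟩

/-- The amalgam is built inside `E`: once an isometry has moved the copy of `Y` so that the two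
images of `X` are close, the sum of the copies of `Y` and `Z` lies in the age of `E`. -/
theorem isAmalgamationClass_of_classEquiv (h : ClassEquiv G (Age 𝕜 E)) (hE : IsGFraisse G E) :
    IsAmalgamationClass G := by
  constructor
  · obtain ⟨Z, hZ, ⟨e⟩⟩ := h.2 ⟨(⊥ : Submodule 𝕜 E)⟩ ⟨⊥, inferInstance, rfl⟩
    exact ⟨Z, hZ, e.toLinearEquiv.finrank_eq.symm.trans (finrank_bot 𝕜 E)⟩
  · intro k ε hε
    obtain ⟨δ, hδ, H⟩ := hE.2 k ε hε
    refine ⟨δ, hδ, fun X hX hk Y hY Z hZ γ η hγ hη => ?_⟩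
    obtain ⟨a⟩ := exists_isometry_of_classLE_age h.1 hY
    obtain ⟨b⟩ := exists_isometry_of_classLE_age h.1 hZ
    obtain ⟨g, hg⟩ := H X hX hk _ _ (hγ.isometry_comp a) (hη.isometry_comp b)
    let a' := g.toLinearIsometry.comp a
    let W := LinearMap.range a'.toLinearMap ⊔ LinearMap.range b.toLinearMap
    obtain ⟨K, hK, ⟨e⟩⟩ := h.2 ⟨W⟩ ⟨W, inferInstance, rfl⟩
    let e' : W ≃ₗᵢ[𝕜] K := e
    let i : Y →ₗᵢ[𝕜] W :=
      ⟨a'.toLinearMap.codRestrict W fun y => Submodule.mem_sup_left ⟨y, rfl⟩, a'.norm_map⟩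
    let j : Z →ₗᵢ[𝕜] W :=
      ⟨b.toLinearMap.codRestrict W fun y => Submodule.mem_sup_right ⟨y, rfl⟩, b.norm_map⟩
    refine ⟨K, hK, e'.toLinearIsometry.comp i, e'.toLinearIsometry.comp j, le_trans ?_ hg.le⟩
    refine ContinuousLinearMap.opNorm_le_bound _ (norm_nonneg _) fun x => ?_
    change ‖e' (i (γ x)) - e' (j (η x))‖ ≤ _
    rw [← map_sub, e'.norm_map]
    exact ContinuousLinearMap.le_opNorm (g.toLinearIsometry.toContinuousLinearMap.comp
      (a.toContinuousLinearMap.comp γ) - b.toContinuousLinearMap.comp η) x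

/-- A sequence of members of `G` whose Auerbach coordinate norms converge fast is realized in `E`
by convergent sequences of vectors. -/
theorem exists_realization [CompleteSpace E] (hE : IsGFraisse G E) {k : ℕ}
    {X : ℕ → FDSpace.{u} 𝕜} (hX : ∀ n, X n ∈ G ∧ (X n).dim = k)
    (b : ∀ n, Module.Basis (Fin k) 𝕜 (X n)) (hb1 : ∀ n i, ‖b n i‖ ≤ 1)
    (hb2 : ∀ n (a : Fin k → 𝕜), ‖a‖ ≤ ‖∑ i, a i • b n i‖)
    (hc : CauchySeq fun n => coordNorm (𝕜 := 𝕜) (b n)) :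
    ∃ (φ : ℕ → ℕ) (v : ℕ → Fin k → E) (v' : Fin k → E), StrictMono φ ∧
      (∀ n (a : Fin k → 𝕜), ‖∑ i, a i • v n i‖ = ‖∑ i, a i • b (φ n) i‖) ∧
      Tendsto v atTop (𝓝 v') := by
  choose δ hδ H using fun n : ℕ => hE.2 k (1 / 2 / 2 ^ n) (by positivity)
  -- Along `φ`, consecutive coordinate norms are so close that sending one basis to the next is a `δ
  -- n`-embedding.
  obtain ⟨φ, hφ, hd⟩ := hc.subseq_mem fun n => Metric.dist_mem_uniformity
    (perturbRadius_pos le_rfl (hδ n))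
  have hemb : ∀ n, Nonempty (X n →ₗᵢ[𝕜] E) := fun n =>
    exists_isometry_of_classLE_age hE.1 (hX n).1
  obtain ⟨i₀⟩ := hemb (φ 0)
  obtain ⟨v, -, hv, hvd⟩ := exists_seq_of_step
    (fun n (v : Fin k → E) => ∀ a : Fin k → 𝕜, ‖∑ i, a i • v i‖ = ‖∑ i, a i • b (φ n) i‖)
    (fun n v w => dist v w ≤ 1 / 2 / 2 ^ n) (fun i => i₀ (b (φ 0) i))
    (fun a => by rw [← i₀.norm_map]; simp) (fun n v hv => by
      obtain ⟨A⟩ := hemb (φ (n + 1))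
      have hu := isDeltaEmb_constr (b (φ n)) (hb2 _) (b (φ (n + 1))) (hδ n) fun a => by
        refine (abs_norm_sum_sub_le_dist _ _ a).trans ?_
        have h1 : dist (coordNorm (𝕜 := 𝕜) (b (φ (n + 1)))) (coordNorm (𝕜 := 𝕜) (b (φ n)))
          < perturbRadius 0 (δ n) := hd n
        rw [dist_comm]
        gcongr
      have hη := isDeltaEmb_constr (b (φ n)) (hb2 _) v (hδ n) fun a => by
        rw [hv, sub_self, abs_zero]
        exact mul_nonneg (perturbRadius_pos le_rfl (hδ n)).le (norm_nonneg _)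
      -- A fresh copy of the next space is moved so that its basis is within `1 / 2 / 2 ^ n` of `v`;
      -- hence the realised bases form a Cauchy sequence.
      obtain ⟨g, hg⟩ := H n _ (hX (φ n)).1 (hX (φ n)).2 _ _ (hu.isometry_comp A) hη
      refine ⟨fun i => g (A (b (φ (n + 1)) i)), fun a => ?_, ?_⟩
      · rw [← A.norm_map, ← g.norm_map (A _)]
        simp
      · rw [dist_comm, dist_pi_le_iff (by positivity)]
        intro i
        have h2 := (ContinuousLinearMap.le_opNorm _ (b (φ n) i)).trans
          (mul_le_mul hg.le (hb1 (φ n) i) (norm_nonneg _) (by positivity))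
        rw [dist_eq_norm]
        simpa using h2)
  obtain ⟨v', hv'⟩ := cauchySeq_tendsto_of_complete (cauchySeq_of_le_geometric_two hvd)
  exact ⟨φ, v, v', hφ, hv, hv'⟩

/-- Arzelà–Ascoli gives a limit norm, but not that it belongs to `G`. Realising the convergence
inside `E` exhibits the limit as the norm of a subspace of `E`, hence of a member of `G`. -/
theorem isBMCompact_of_classEquiv [CompleteSpace E] (h : ClassEquiv G (Age 𝕜 E))
    (hE : IsGFraisse G E) : IsBMCompact G := by
  intro k X hX
  choose b hb1 hb2 using fun n => exists_auerbach_basis (𝕜 := 𝕜) (X := X n) (hX n).2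
  obtain ⟨f, -, φ, hφ, hf⟩ := (isCompact_closure_coordNorm.{u} 𝕜 k).tendsto_subseq
    (x := fun n => coordNorm (b n)) fun n => subset_closure ⟨X n, b n, hb1 n, rfl⟩
  obtain ⟨ψ, v, w, hψ, hv, hvw⟩ := exists_realization hE (fun n => hX (φ n)) (fun n => b (φ n))
    (fun n => hb1 (φ n)) (fun n => hb2 (φ n)) hf.cauchySeq
  have hf' : Tendsto (fun n => coordNorm (𝕜 := 𝕜) (b (φ (ψ n)))) atTop (𝓝 f) :=
    hf.comp hψ.tendsto_atTop
  have hsum : ∀ a : Fin k → 𝕜,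
      Tendsto (fun n => ‖∑ i, a i • b (φ (ψ n)) i‖) atTop (𝓝 ‖∑ i, a i • w i‖) := fun a => by
    simp only [← hv]
    exact (tendsto_finsetSum _ fun i _ => ((tendsto_pi_nhds.1 hvw i).const_smul (a i))).norm
  -- The Auerbach lower bound survives the limit; it makes `w` independent, so no dimension is lost.
  have hlow : ∀ a : Fin k → 𝕜, ‖a‖ ≤ ‖∑ i, a i • w i‖ := fun a =>
    ge_of_tendsto' (hsum a) fun n => hb2 _ a
  have hdist : ∀ n (a : Fin k → 𝕜), |‖∑ i, a i • b (φ (ψ n)) i‖ - ‖∑ i, a i • w i‖| ≤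
      dist (coordNorm (𝕜 := 𝕜) (b (φ (ψ n)))) f * ‖a‖ := fun n =>
    abs_norm_sum_sub_le _ _ fun a => by
      have h1 : f a = ‖∑ i, (a : Fin k → 𝕜) i • w i‖ := tendsto_nhds_unique
        (((continuous_eval_const a).tendsto f).comp hf')
        (hsum a)
      rw [← h1, ← coordNorm_apply, ← Real.dist_eq]
      exact BoundedContinuousFunction.dist_coe_le_dist a
  have hli : LinearIndependent 𝕜 w := Fintype.linearIndependent_iff.2 fun a ha i => by
    have h1 := hlow a
    rw [ha, norm_zero] at h1
    rw [norm_le_zero_iff.1 h1]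
    rfl
  let V := Submodule.span 𝕜 (Set.range w)
  have hVfin : FiniteDimensional 𝕜 V := FiniteDimensional.span_of_finite 𝕜 (Set.finite_range w)
  have hVdim : Module.finrank 𝕜 V = k := (finrank_span_eq_card hli).trans (Fintype.card_fin k)
  obtain ⟨Y, hY, ⟨e⟩⟩ := h.2 ⟨V⟩ ⟨V, hVfin, rfl⟩
  let e' : V ≃ₗᵢ[𝕜] Y := e
  have hYdim : Y.dim = k := e'.toLinearEquiv.finrank_eq.symm.trans hVdim
  refine ⟨Y, hY, hYdim, φ ∘ ψ, hφ.comp hψ, ?_⟩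
  rw [Metric.tendsto_nhds]
  intro ε hε
  -- Chosen so that `2 * Real.log (1 + δ) = ε / 2 < ε`.
  let δ := Real.exp (ε / 4) - 1
  have hδ : 0 < δ := by
    have := Real.add_one_lt_exp (by positivity : ε / 4 ≠ 0)
    simp only [δ]; linarith
  filter_upwards [Metric.tendsto_nhds.1 hf' _ (perturbRadius_pos le_rfl hδ)] with n hn
  let c : Fin k → V := fun i => ⟨w i, Submodule.subset_span ⟨i, rfl⟩⟩
  have hT := isDeltaEmb_constr (b (φ (ψ n))) (hb2 _) c hδ fun a => by
    have e1 : ‖∑ i, a i • c i‖ = ‖∑ i, a i • w i‖ := by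
      rw [← Submodule.norm_coe]
      simp [c]
    rw [e1]
    exact (hdist n a).trans (by gcongr)
  have h1 := abs_dBM_le (((hX _).2).trans hYdim.symm) hδ.le (hT.isometry_comp e'.toLinearIsometry)
  rw [Real.dist_eq, sub_zero]
  refine lt_of_le_of_lt h1 ?_
  simp only [δ, add_sub_cancel, Real.log_exp]
  linarith

theorem isFraisseClass_of_classEquiv [CompleteSpace E] (hE : IsFraisse 𝕜 E)
    (h : ClassEquiv G (Age 𝕜 E)) : IsFraisseClass G := by
  have hG : IsGFraisse G E := IsGFraisse.of_classLE hE h.1 h.1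
  exact ⟨isHereditary_of_classEquiv h, isBMCompact_of_classEquiv h hG,
    isAmalgamationClass_of_classEquiv h hG⟩

/-- The limit has its age in `G`, so being `G`-Fraïssé upgrades to being Fraïssé. Any competitor `F`
has `Age(F) ≡ G`, hence is `G`-Fraïssé and in `[G]`, and uniqueness of the limit applies. -/
theorem IsFraisseClass.exists_space (hG : IsFraisseClass G) :
    ∃ (E : Type u) (_ : NormedAddCommGroup E) (_ : NormedSpace 𝕜 E) (_ : CompleteSpace E),
      TopologicalSpace.SeparableSpace E ∧ IsFraisse 𝕜 E ∧ ClassEquiv G (Age 𝕜 E) ∧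
      IsFraisseLimit G E ∧
      ∀ (F : Type u) [NormedAddCommGroup F] [NormedSpace 𝕜 F] [CompleteSpace F],
        TopologicalSpace.SeparableSpace F → IsFraisse 𝕜 F → ClassEquiv G (Age 𝕜 F) →
        Isometric 𝕜 E F := by
  obtain ⟨E, _, _, _, hE, -⟩ := exists_fraisseLimit hG.2.2
  have hle := age_classLE hG.1 hG.2.1 hE.bracket.approxBy
  have hrefl : ClassLE (Age 𝕜 E) (Age 𝕜 E) := fun X hX => ⟨X, hX, ⟨LinearIsometryEquiv.refl 𝕜 X⟩⟩
  refine ⟨E, _, _, _, hE.separable, hE.fraisse.of_classLE hrefl hle, ⟨hE.fraisse.1, hle⟩, hE, ?_⟩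
  intro F _ _ _ hFs hF hFG
  exact hE.unique F hFs (IsGFraisse.of_classLE hF hFG.1 hFG.1)
    (approxBy_of_age_classLE hFG.2).inBracket

end Correspondence

end FraisseBanach

theorem corollary2p27 {𝕜 : Type v} [RCLike 𝕜] (G : Set (FraisseBanach.FDSpace.{u} 𝕜)) :
    -- the correspondence
    (List.TFAE
      [FraisseBanach.IsFraisseClass G,
       ∃ (E : Type u) (_ : NormedAddCommGroup E) (_ : NormedSpace 𝕜 E) (_ : CompleteSpace E),
         TopologicalSpace.SeparableSpace E ∧ FraisseBanach.IsFraisse 𝕜 E ∧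
         FraisseBanach.ClassEquiv G (FraisseBanach.Age 𝕜 E),
       ∃ (E : Type u) (_ : NormedAddCommGroup E) (_ : NormedSpace 𝕜 E) (_ : CompleteSpace E),
         TopologicalSpace.SeparableSpace E ∧ FraisseBanach.IsFraisse 𝕜 E ∧
         FraisseBanach.ClassEquiv G (FraisseBanach.Age 𝕜 E) ∧
         FraisseBanach.IsFraisseLimit G E ∧
         ∀ (F : Type u) [NormedAddCommGroup F] [NormedSpace 𝕜 F] [CompleteSpace F],
           TopologicalSpace.SeparableSpace F → FraisseBanach.IsFraisse 𝕜 F →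
           FraisseBanach.ClassEquiv G (FraisseBanach.Age 𝕜 F) →
           FraisseBanach.Isometric 𝕜 E F]) ∧
    -- existence of the limit of an amalgamation class, with its modulus
    (FraisseBanach.IsAmalgamationClass G →
      ∃ (E : Type u) (_ : NormedAddCommGroup E) (_ : NormedSpace 𝕜 E) (_ : CompleteSpace E),
        FraisseBanach.IsFraisseLimit G E ∧
        (∀ w : ℕ → NNReal → NNReal, FraisseBanach.HasAmalgamationModulus G w →
          FraisseBanach.HasGFraisseModulus G E (FraisseBanach.modulusStar w)) ∧
        ∃ (X : ℕ → FraisseBanach.FDSpace.{u} 𝕜) (I : ∀ n, X n →ₗᵢ[𝕜] X (n + 1)),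
          (∀ n, X n ∈ G) ∧ FraisseBanach.IsInductiveLimit X I E) ∧
    -- uniqueness
    (∀ (E F : Type u) [NormedAddCommGroup E] [NormedSpace 𝕜 E] [CompleteSpace E]
        [NormedAddCommGroup F] [NormedSpace 𝕜 F] [CompleteSpace F],
      TopologicalSpace.SeparableSpace E → TopologicalSpace.SeparableSpace F →
      FraisseBanach.IsGFraisse G E → FraisseBanach.IsGFraisse G F →
      FraisseBanach.InBracket G E →
      (FraisseBanach.InBracket G F ↔ FraisseBanach.Isometric 𝕜 E F)) ∧
    -- the limit has infinite dimension exactly when the dimensions in the class are unbounded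
    (∀ (E : Type u) [NormedAddCommGroup E] [NormedSpace 𝕜 E] [CompleteSpace E],
      FraisseBanach.IsFraisseLimit G E →
      (¬ FiniteDimensional 𝕜 E ↔ ∀ n : ℕ, ∃ X ∈ G, n ≤ X.dim)) := by

  refine ⟨?_, FraisseBanach.exists_fraisseLimit, ?_, ?_⟩
  · tfae_have 1 → 3 := fun h => h.exists_space
    tfae_have 3 → 2 := fun ⟨E, h1, h2, h3, hs, hF, hG, _⟩ => ⟨E, h1, h2, h3, hs, hF, hG⟩
    tfae_have 2 → 1 := fun ⟨_, _, _, _, _, hF, hG⟩ =>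
      FraisseBanach.isFraisseClass_of_classEquiv hF hG
    tfae_finish
  · intro E F _ _ _ _ _ _ hEs hFs hE hF hEb
    exact ⟨FraisseBanach.isometric_of_isGFraisse hE hF hEb, hEb.of_isometric⟩
  · intro E _ _ _ h
    exact h.infinite_dimensional_iff
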